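/- Let $k$ be a field of characteristic zero and $\mathbb N=\{0,1,2,\dots\}$. An arithmetic progression is a subset of $\mathbb N$ of the form $j+\mathbb N l$ with $j,l\in\mathbb N$ (so singletons are allowed). Let $K=k(z)$ with the endomorphism $\sigma(h(z))=h(z+1)$, and let $\mathrm{Seq}_k$ be the ring of sequences $\mathbb N\to k$, two sequences being identified if they agree at all sufficiently large indices, with the shift $\sigma(f)=(f(1),f(2),\dots)$ and with $K$ embedded by $h\mapsto(h(0),h(1),\dots)$ (defined for all but finitely many indices). A ring $L$ with an endomorphism $\sigma$ is a $\sigma$-pseudo field if for some $l\ge1$ there are orthogonal idempotents $e_0,\dots,e_{l-1}\in L$ with $L=e_0L\oplus\dots\oplus e_{l-1}L$, $\sigma(e_0)=e_1,\dots,\sigma(e_{l-2})=e_{l-1}$, $\sigma(e_{l-1})=e_0$, and every $e_iL$ a field. For $A\in\mathrm{GL}_n(K)$, a Picard–Vessiot extension of $K$ for $\sigma(y)=Ay$ inside $\mathrm{Seq}_k$ is a $\sigma$-stable $K$-subalgebra $L\subseteq\mathrm{Seq}_k$ that is a $\sigma$-pseudo field, such that there is $Y\in\mathrm{GL}_n(L)$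 with $\sigma(Y)=AY$ for which $L$ is the total ring of fractions of $K[Y_{ij}]$, and such that $\{x\in L\mid\sigma(x)=x\}=\{c\in K\mid\sigma(c)=c\}$. **Theorem.** The following three statements are equivalent. 1. For every $n\in\mathbb N$ and every $A\in\mathrm{GL}_n(k(z))$, the rational map $\sigma\colon X\dashrightarrow X$, $\sigma(b,B)=(b+1,A(b)B)$, on $X=\mathbb A^1_k\times\mathrm{GL}_{n,k}$ has the following property: for every closed subvariety $Y\subseteq X$ and every $x\in X(k)$ whose orbit is defined (that is, each of $x,\sigma(x),\sigma^2(x),\dots$ lies in the domain of definition of $\sigma$), the set $\{i\in\mathbb N\mid\sigma^i(x)\in Y\}$ is a finite union of arithmetic progressions. 2. For every $n\in\mathbb N$, all $h_0,\dots,h_{n-1}\in k(z)$ and every sequence $f\colon\mathbb N\to k$ such that $f(i+n)+h_{n-1}(i)f(i+n-1)+\dots+h_0(i)f(i)=0$ for all sufficiently large $i$, the set $\{i\in\mathbb N\mid f(i)=0\}$ is a finite union of arithmetic progressions. 3. For every $n\in\mathbb N$ and every $A\in\mathrm{GL}_n(k(z))$ there exists a Picard–Vessiot extension of $k(z)$ for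 $\sigma(y)=Ay$ inside $\mathrm{Seq}_k$. -/

import Mathlib

open Filter

noncomputable section

namespace DifferenceEq

/-- `S ⊆ ℕ` is a finite union of arithmetic progressions `j + ℕ l` with `j, l ∈ ℕ`
(`l = 0` is allowed, so singletons are arithmetic progressions; the empty union is allowed). -/
def IsFiniteUnionAP (S : Set ℕ) : Prop :=
  ∃ T : Finset (ℕ × ℕ), S = {i | ∃ p ∈ T, ∃ m : ℕ, i = p.1 + m * p.2}

/-! ### The difference field `k(z)` -/

section RationalFunctions

variable {k : Type*} [Field k]

/-- The value `h(b)` of a rational function; it is meaningful where `h` is regular. -/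
def value (h : RatFunc k) (b : k) : k := RatFunc.eval (RingHom.id k) b h

/-- The rational function `h` has no pole at `b`. -/
def RegularAt (h : RatFunc k) (b : k) : Prop := h.denom.eval b ≠ 0

variable (k) in
/-- The endomorphism `h(z) ↦ h(z + 1)` of `k(z)`. -/
def shiftRatFunc : RatFunc k →+* RatFunc k :=
  RatFunc.mapRingHom (Polynomial.taylorAlgHom (1 : k)).toRingHom
    (nonZeroDivisors_le_comap_nonZeroDivisors_of_injective _ (Polynomial.taylor_injective 1))

end RationalFunctions

/-! ### The difference ring of sequences -/

/-- The ring of `k`-valued sequences, two sequences being identified if they agree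
at all sufficiently large indices. -/
def Seq (k : Type*) : Type _ := Germ (atTop : Filter ℕ) k

section Sequences

variable {k : Type*}

/-- The class of a sequence. -/
def Seq.mk (f : ℕ → k) : Seq k := Germ.ofFun f

theorem Seq.mk_eq_mk {f g : ℕ → k} : Seq.mk f = Seq.mk g ↔ ∀ᶠ i in atTop, f i = g i :=
  Germ.coe_eq

theorem Seq.exists_mk (x : Seq k) : ∃ f : ℕ → k, Seq.mk f = x := Quotient.exists_rep x

variable [Field k]

instance : CommRing (Seq k) := inferInstanceAs (CommRing (Germ (atTop : Filter ℕ) k))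

variable (k) in
/-- The left shift `(f(0), f(1), …) ↦ (f(1), f(2), …)` on classes of sequences. -/
def shiftSeq : Seq k →+* Seq k where
  toFun x := Germ.compTendsto (β := k) x (fun i : ℕ => i + 1) (tendsto_add_atTop_nat 1)
  map_one' := rfl
  map_zero' := rfl
  map_mul' x y := by
    obtain ⟨f, rfl⟩ := x.exists_mk
    obtain ⟨g, rfl⟩ := y.exists_mk
    rfl
  map_add' x y := by
    obtain ⟨f, rfl⟩ := x.exists_mk
    obtain ⟨g, rfl⟩ := y.exists_mk
    rfl

theorem shiftSeq_mk (f : ℕ → k) : shiftSeq k (Seq.mk f) = Seq.mk fun i => f (i + 1) := rfl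

variable [CharZero k]

theorem eventually_regularAt (h : RatFunc k) : ∀ᶠ i : ℕ in atTop, RegularAt h (i : k) := by
  have hfin : {i : ℕ | h.denom.eval (i : k) = 0}.Finite := by
    have hr : {x : k | h.denom.IsRoot x}.Finite :=
      Polynomial.finite_setOfPred_isRoot h.denom_ne_zero
    exact hr.preimage (Nat.cast_injective.injOn)
  have := hfin.eventually_cofinite_notMem
  rw [Nat.cofinite_eq_atTop] at this
  exact this

variable (k) in
/-- The embedding `h ↦ (h(0), h(1), h(2), …)` of `k(z)` into the ring of sequences;
it is well defined as `h` has only finitely many poles. -/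
def ratFuncToSeq : RatFunc k →+* Seq k where
  toFun h := Seq.mk fun i => value h (i : k)
  map_one' := Seq.mk_eq_mk.2 (Eventually.of_forall fun i => by simp [value])
  map_zero' := Seq.mk_eq_mk.2 (Eventually.of_forall fun i => by simp [value])
  map_mul' x y := by
    refine Seq.mk_eq_mk.2 ?_
    filter_upwards [eventually_regularAt x, eventually_regularAt y] with i hx hy
    exact RatFunc.eval_mul (f := RingHom.id k) (a := (i : k)) hx hy
  map_add' x y := by
    refine Seq.mk_eq_mk.2 ?_
    filter_upwards [eventually_regularAt x, eventually_regularAt y] with i hx hy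
    exact RatFunc.eval_add (f := RingHom.id k) (a := (i : k)) hx hy

/-- The ring of sequences as a `k(z)`-algebra. -/
instance : Algebra (RatFunc k) (Seq k) := (ratFuncToSeq k).toAlgebra

end Sequences

/-! ### Picard–Vessiot extensions -/

section PicardVessiot

/-- A difference ring `(L, σ)` is a `σ`-pseudo field: there are an integer `l = m + 1 ≥ 1` and
orthogonal idempotents `e₀, …, e_{l-1}` with `L = e₀L ⊕ ⋯ ⊕ e_{l-1}L`, which `σ` permutes
cyclically (addition in `Fin (m + 1)` is modulo `m + 1`), such that every ring `eᵢL`, whose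
identity element is `eᵢ`, is a field. -/
def IsPseudoField {L : Type*} [CommRing L] (σ : L →+* L) : Prop :=
  ∃ (m : ℕ) (e : Fin (m + 1) → L),
    CompleteOrthogonalIdempotents e ∧
    (∀ i, σ (e i) = e (i + 1)) ∧
    ∀ i, e i ≠ 0 ∧ ∀ x, e i * x ≠ 0 → ∃ y, (e i * x) * (e i * y) = e i

/-- The difference algebra `(L, σL)` over the difference field `(K, σK)` is a Picard–Vessiot
extension for `σ(y) = A y`. -/
structure IsPicardVessiotExtension {K L : Type*} [Field K] [CommRing L] [Algebra K L]
    (σK : K →+* K) (σL : L →+* L) {n : ℕ} (A : GL (Fin n) K) : Prop where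
  /-- `L` is a `K`-`σ`-algebra. -/
  commutes : ∀ a : K, σL (algebraMap K L a) = algebraMap K L (σK a)
  pseudoField : IsPseudoField σL
  /-- There is a fundamental solution matrix `Y` such that `L` is the total ring of fractions
  of `K[Y i j]`. -/
  generated : ∃ Y : GL (Fin n) L,
    (Y : Matrix (Fin n) (Fin n) L).map σL =
      (A : Matrix (Fin n) (Fin n) K).map (algebraMap K L) * (Y : Matrix (Fin n) (Fin n) L) ∧
    IsFractionRing
      (Algebra.adjoin K (Set.range fun p : Fin n × Fin n =>
        (Y : Matrix (Fin n) (Fin n) L) p.1 p.2)) L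
  /-- `L` has the same constants as `K`. -/
  constants : ∀ x : L, σL x = x ↔ ∃ c : K, σK c = c ∧ algebraMap K L c = x

/-- There is a Picard–Vessiot extension of `k(z)` for `σ(y) = A y` inside the ring of sequences,
that is, one which is a shift-stable `k(z)`-subalgebra of that ring. -/
def HasPVExtensionInSeq {k : Type*} [Field k] [CharZero k] {n : ℕ}
    (A : GL (Fin n) (RatFunc k)) : Prop :=
  ∃ (L : Subalgebra (RatFunc k) (Seq k)) (hL : ∀ x ∈ L, shiftSeq k x ∈ L),
    IsPicardVessiotExtension (shiftRatFunc k) ((shiftSeq k).restrict L L hL) A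

end PicardVessiot

/-! ### The rational self-map of `𝔸¹ × GLₙ` -/

section Dynamics

variable {k : Type*} [Field k] {n : ℕ}

variable (k n) in
/-- The `k`-points `(b, B)` of `X = 𝔸¹ × GLₙ`. -/
abbrev Pt : Type _ := k × GL (Fin n) k

/-- The coordinates of `(b, B)` in the affine space `𝔸^(1 + n²)` of which `X` is an open
subvariety: `none` is the coordinate `z`, and `some (i, j)` is the matrix coordinate `Z i j`. -/
def coords (x : Pt k n) : Option (Fin n × Fin n) → k
  | none => x.1
  | some p => (x.2 : Matrix (Fin n) (Fin n) k) p.1 p.2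

/-- The set of `k`-points of a closed subvariety of `X`, that is, the set of common zeros in
`X(k)` of a set of polynomials in `z` and the `Z i j`. (Allowing `1 / det Z` as well would give
the same sets, since denominators can be cleared.) -/
def IsClosedSubvariety (Y : Set (Pt k n)) : Prop :=
  ∃ S : Set (MvPolynomial (Option (Fin n × Fin n)) k),
    Y = {x | ∀ p ∈ S, MvPolynomial.eval (coords x) p = 0}

/-- The matrix `A(b)`. -/
def valueMatrix (A : GL (Fin n) (RatFunc k)) (b : k) : Matrix (Fin n) (Fin n) k :=
  (A : Matrix (Fin n) (Fin n) (RatFunc k)).map fun h => value h b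

/-- The domain of definition of the rational map `(b, B) ↦ (b + 1, A(b) B)` from `X` to `X`.
As `B` is invertible, the entries of `A(z) Z` are regular at `(b, B)` if and only if those of `A`
are regular at `b`, and then the value lies in `X` if and only if `det A(b) ≠ 0`. -/
def stepDomain (A : GL (Fin n) (RatFunc k)) : Set (Pt k n) :=
  {x | (∀ i j, RegularAt ((A : Matrix (Fin n) (Fin n) (RatFunc k)) i j) x.1) ∧
    (valueMatrix A x.1).det ≠ 0}

open Classical in
/-- The rational map `(b, B) ↦ (b + 1, A(b) B)`. Outside its domain of definition the
value is a placeholder. -/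
def step (A : GL (Fin n) (RatFunc k)) (x : Pt k n) : Pt k n :=
  if h : x ∈ stepDomain A then
    (x.1 + 1, Matrix.GeneralLinearGroup.mkOfDetNeZero (valueMatrix A x.1) h.2 * x.2)
  else x

/-- The orbit of `x` is defined: `x`, `σ(x)`, `σ²(x)`, … all lie in the domain of `σ`. -/
def OrbitDefined (A : GL (Fin n) (RatFunc k)) (x : Pt k n) : Prop :=
  ∀ i : ℕ, (step A)^[i] x ∈ stepDomain A

end Dynamics

/-- The sequence `f` solves `σⁿ(y) + h_{n-1} σⁿ⁻¹(y) + ⋯ + h₀ y = 0`: the recurrence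
`f(i+n) + h_{n-1}(i) f(i+n-1) + ⋯ + h₀(i) f(i) = 0` holds for all sufficiently large `i`. -/
def IsSolution {k : Type*} [Field k] {n : ℕ} (h : Fin n → RatFunc k) (f : ℕ → k) : Prop :=
  ∀ᶠ i : ℕ in atTop, f (i + n) + ∑ j : Fin n, value (h j) (i : k) * f (i + j) = 0

end DifferenceEq

end

noncomputable section

namespace DifferenceEq

/-! A finite union of progressions is the same as an eventually periodic set
(`isFiniteUnionAP_iff`). This property ignores finitely many indices, so it can be asked of classes
in `Seq k`. Statement 2 is the hub: it says that every element of the algebra `recurrent k`, the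
union of the finite-dimensional shift-stable `k(z)`-subspaces, has an eventually periodic zero set
(`exists_isSolution`, `periodicZeros_of_mem_recurrent`).

From 2 to 1: a polynomial evaluated along an orbit is recurrent (`orbit_mem_recurrent`), and
finitely many polynomials cut out a closed subvariety. Conversely, 1 and 3 each control all solution
vectors of systems `σ(v) = A v`. Under 1, such a vector is read off an orbit in `X` by a linear form
(`systemsHavePeriodicZeros_of_orbits`). Under 3, it is a combination of the columns of a fundamental
matrix with constant coefficients, so its entries lie in a pseudo field, where zero sets are
eventually periodic (`periodicZeros_of_mem_pseudoField`). Companion matrices then give 2.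

From 2 to 3: let `R` be the algebra generated by a fundamental matrix of sequences. It is
Noetherian, and each element has periodic zeros with a period of its own. Maximality of a vanishing
ideal yields one period `l` for all of `R` (`exists_forall_dichotomy`). The least such `l` lets `R`
separate residue classes, so `R` contains elements supported exactly on each class
(`exists_support_eq_ind`). Inverting the units of `Seq k` that lie in `R` then produces the
indicators of the classes, and a field on each class. No new constants can occur, since a
shift-invariant class of sequences is constant. -/

/-! ### Eventually periodic sets -/

/-- A set of natural numbers is eventually periodic. -/
def EventuallyPeriodic (S : Set ℕ) : Prop :=
  ∃ l : ℕ, 0 < l ∧ ∀ᶠ i in atTop, (i ∈ S ↔ i + l ∈ S)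

theorem exists_forall_modEq {S : Set ℕ} {l : ℕ} (h : ∀ᶠ i in atTop, (i ∈ S ↔ i + l ∈ S)) :
    ∃ N, ∀ i ≥ N, ∀ j ≥ N, i ≡ j [MOD l] → (i ∈ S ↔ j ∈ S) := by
  obtain ⟨N, hN⟩ := eventually_atTop.1 h
  have key : ∀ m : ℕ, ∀ i ≥ N, (i ∈ S ↔ i + l * m ∈ S) := by
    intro m i hi
    induction m with
    | zero => simp
    | succ m ih => rw [ih, hN _ (by omega), mul_add, mul_one, add_assoc]
  have aux : ∀ i ≥ N, ∀ j ≥ N, i ≤ j → i ≡ j [MOD l] → (i ∈ S ↔ j ∈ S) := by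
    intro i hi j _ hij h
    obtain ⟨m, hm⟩ := (Nat.modEq_iff_dvd' hij).1 h
    rw [key m i hi, ← hm, Nat.add_sub_cancel' hij]
  refine ⟨N, fun i hi j hj h => ?_⟩
  rcases le_total i j with hij | hij
  · exact aux i hi j hj hij h
  · exact (aux j hj i hi hij h.symm).symm

theorem eventually_mem_iff_add_mul {S : Set ℕ} {l : ℕ}
    (h : ∀ᶠ i in atTop, (i ∈ S ↔ i + l ∈ S)) (m : ℕ) :
    ∀ᶠ i in atTop, (i ∈ S ↔ i + l * m ∈ S) := by
  obtain ⟨N, hN⟩ := exists_forall_modEq h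
  filter_upwards [eventually_ge_atTop N] with i hi
  exact hN i hi _ (by omega) (by simp [Nat.ModEq])

theorem EventuallyPeriodic.congr {S T : Set ℕ} (hS : EventuallyPeriodic S)
    (h : ∀ᶠ i in atTop, (i ∈ S ↔ i ∈ T)) : EventuallyPeriodic T := by
  obtain ⟨l, hl, hS⟩ := hS
  refine ⟨l, hl, ?_⟩
  filter_upwards [hS, h, (tendsto_add_atTop_nat l).eventually h] with i h1 h2 h3
  rw [← h2, h1, h3]

/-- The product of the two periods is a common period. The hypothesis says that membership in `U` is
a function of membership in `S` and `T`, which covers all Boolean operations at once. -/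
theorem EventuallyPeriodic.binary {S T U : Set ℕ} (hS : EventuallyPeriodic S)
    (hT : EventuallyPeriodic T)
    (h : ∀ i j, (i ∈ S ↔ j ∈ S) → (i ∈ T ↔ j ∈ T) → (i ∈ U ↔ j ∈ U)) :
    EventuallyPeriodic U := by
  obtain ⟨l, hl, hS⟩ := hS
  obtain ⟨m, hm, hT⟩ := hT
  refine ⟨l * m, Nat.mul_pos hl hm, ?_⟩
  filter_upwards [eventually_mem_iff_add_mul hS m, eventually_mem_iff_add_mul hT l] with i h1 h2
  exact h _ _ h1 (by rwa [mul_comm m l] at h2)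

theorem EventuallyPeriodic.of_forall {S : Set ℕ} (h : ∀ i, i ∈ S) : EventuallyPeriodic S :=
  ⟨1, one_pos, Eventually.of_forall fun i => by simp [h]⟩

theorem EventuallyPeriodic.of_forall_not {S : Set ℕ} (h : ∀ i, i ∉ S) : EventuallyPeriodic S :=
  ⟨1, one_pos, Eventually.of_forall fun i => by simp [h]⟩

theorem EventuallyPeriodic.inter {S T : Set ℕ} (hS : EventuallyPeriodic S)
    (hT : EventuallyPeriodic T) : EventuallyPeriodic (S ∩ T) :=
  hS.binary hT fun i j h1 h2 => by simp [h1, h2]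

theorem EventuallyPeriodic.union {S T : Set ℕ} (hS : EventuallyPeriodic S)
    (hT : EventuallyPeriodic T) : EventuallyPeriodic (S ∪ T) :=
  hS.binary hT fun i j h1 h2 => by simp [h1, h2]

theorem EventuallyPeriodic.of_shift {S : Set ℕ} (N : ℕ)
    (h : EventuallyPeriodic {i | i + N ∈ S}) : EventuallyPeriodic S := by
  obtain ⟨l, hl, h⟩ := h
  refine ⟨l, hl, ?_⟩
  obtain ⟨M, hM⟩ := eventually_atTop.1 h
  filter_upwards [eventually_ge_atTop (M + N)] with i hi
  have := hM (i - N) (by omega)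
  simp only [Set.mem_ofPred_eq] at this
  rwa [show i - N + N = i by omega, show i - N + l + N = i + l by omega] at this

theorem eventuallyPeriodic_progression (j l : ℕ) :
    EventuallyPeriodic {i | ∃ m : ℕ, i = j + m * l} := by
  rcases Nat.eq_zero_or_pos l with rfl | hl
  · refine ⟨1, one_pos, ?_⟩
    filter_upwards [eventually_gt_atTop j] with i hi
    simp only [mul_zero, add_zero, exists_const]
    omega
  · refine ⟨l, hl, ?_⟩
    filter_upwards [eventually_ge_atTop j] with i hi
    constructor
    · rintro ⟨m, hm⟩
      exact ⟨m + 1, by rw [hm]; ring⟩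
    · rintro ⟨m, hm⟩
      rcases m with _ | m
      · omega
      · exact ⟨m, by rw [add_mul] at hm; omega⟩

/-- If `S` has period `l` from `N` on, its elements below `N` are progressions of step 0, and each
element in `[N, N + l)` starts a progression of step `l`. -/
theorem isFiniteUnionAP_iff {S : Set ℕ} : IsFiniteUnionAP S ↔ EventuallyPeriodic S := by
  classical
  constructor
  · rintro ⟨T, rfl⟩
    induction T using Finset.induction_on with
    | empty => exact .of_forall_not (by simp)
    | insert p T _ ih =>
      convert (eventuallyPeriodic_progression p.1 p.2).union ih using 1
      ext i
      simp
  · rintro ⟨l, hl, h⟩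
    obtain ⟨N, hN⟩ := exists_forall_modEq h
    refine ⟨((Finset.range N).filter (· ∈ S)).image (fun i => (i, 0)) ∪
      ((Finset.Ico N (N + l)).filter (· ∈ S)).image (fun i => (i, l)), ?_⟩
    ext i
    simp only [Finset.mem_union, Finset.mem_image, Finset.mem_filter, Finset.mem_range,
      Finset.mem_Ico, Set.mem_ofPred_eq]
    constructor
    · intro hi
      rcases lt_or_ge i N with h | h
      · exact ⟨(i, 0), Or.inl ⟨i, ⟨h, hi⟩, rfl⟩, 0, by simp⟩
      · have hmod := Nat.mod_add_div (i - N) l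
        have hlt := Nat.mod_lt (i - N) hl
        have hi' : i = N + (i - N) % l + l * ((i - N) / l) := by omega
        refine ⟨(N + (i - N) % l, l), Or.inr ⟨_, ⟨⟨by omega, by omega⟩, ?_⟩, rfl⟩,
          (i - N) / l, ?_⟩
        · refine (hN i h _ (by omega) ?_).1 hi
          conv_lhs => rw [hi']
          simp [Nat.ModEq]
        · rw [mul_comm ((i - N) / l)]
          exact hi'
    · rintro ⟨p, ⟨j, ⟨hj, hjS⟩, rfl⟩ | ⟨j, ⟨hj, hjS⟩, rfl⟩, m, hm⟩
      · simp only [mul_zero, add_zero] at hm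
        rwa [hm]
      · simp only at hm
        refine (hN j hj.1 i (by omega) ?_).1 hjS
        rw [hm]
        simp [Nat.ModEq]

/-! ### Translation of rational functions -/

section Translate

variable {k : Type*} [Field k]

/-- The endomorphism `h(z) ↦ h(z + b)` of `k(z)`. -/
def translate (b : k) : RatFunc k →+* RatFunc k :=
  RatFunc.mapRingHom (Polynomial.taylorAlgHom b).toRingHom
    (nonZeroDivisors_le_comap_nonZeroDivisors_of_injective _ (Polynomial.taylor_injective b))

theorem translate_one : translate (1 : k) = shiftRatFunc k := rfl

theorem translate_algebraMap (b : k) (p : Polynomial k) :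
    translate b (algebraMap _ _ p) = algebraMap _ _ (Polynomial.taylor b p) := by
  have := RatFunc.map_apply_div (φ := (Polynomial.taylorAlgHom b).toRingHom)
    (nonZeroDivisors_le_comap_nonZeroDivisors_of_injective _ (Polynomial.taylor_injective b)) p 1
  simp only [map_one, div_one] at this
  exact this

theorem value_algebraMap (p : Polynomial k) (a : k) :
    value (algebraMap _ (RatFunc k) p) a = p.eval a := by
  simp [value, RatFunc.eval_algebraMap, Polynomial.eval₂_id]

theorem value_eq_div (h : RatFunc k) (a : k) : value h a = h.num.eval a / h.denom.eval a := by
  simp [value, RatFunc.eval, Polynomial.eval₂_id]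

theorem value_C (c a : k) : value (RatFunc.C c) a = c := by simp [value]

variable [CharZero k]

theorem eventually_eval_add_ne_zero {p : Polynomial k} (hp : p ≠ 0) (b : k) :
    ∀ᶠ i : ℕ in atTop, p.eval (i + b) ≠ 0 := by
  have hfin : {i : ℕ | p.eval (i + b) = 0}.Finite :=
    (Polynomial.finite_setOfPred_isRoot hp).preimage
      (f := fun i : ℕ => (i + b : k)) (fun i _ j _ h => by simpa using h)
  have := hfin.eventually_cofinite_notMem
  rwa [Nat.cofinite_eq_atTop] at this

/-- `value` is not multiplicative at poles. The identity translating `h * denom = num` is therefore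
pushed through the ring homomorphism to `Seq k`, and the denominator is divided out where it does
not vanish. -/
theorem eventually_value_translate (b : k) (h : RatFunc k) :
    ∀ᶠ i : ℕ in atTop, value (translate b h) (i : k) = value h (i + b) := by
  have hd := h.denom_ne_zero
  have h1 : translate b h * algebraMap _ _ (Polynomial.taylor b h.denom) =
      algebraMap _ _ (Polynomial.taylor b h.num) := by
    rw [← translate_algebraMap, ← translate_algebraMap, ← map_mul]
    congr 1
    nth_rewrite 1 [← RatFunc.num_div_denom h]
    exact div_mul_cancel₀ _ (by simpa using hd)
  have h2 := congrArg (ratFuncToSeq k) h1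
  rw [map_mul] at h2
  filter_upwards [Seq.mk_eq_mk.1 h2, eventually_eval_add_ne_zero hd b] with i h3 h4
  simp only [value_algebraMap, Polynomial.taylor_eval] at h3
  rw [value_eq_div h, eq_div_iff h4]
  exact h3

end Translate

/-! ### Sequences -/

section Seq

variable {k : Type*} [Field k]

variable (k) in
/-- `Seq.mk` as a ring homomorphism. -/
def Seq.mkHom : (ℕ → k) →+* Seq k where
  toFun := Seq.mk
  map_one' := rfl
  map_zero' := rfl
  map_mul' _ _ := rfl
  map_add' _ _ := rfl

theorem Seq.mkHom_apply (f : ℕ → k) : Seq.mkHom k f = Seq.mk f := rfl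

theorem Seq.mk_mul (f g : ℕ → k) : Seq.mk f * Seq.mk g = Seq.mk fun i => f i * g i := rfl

theorem Seq.mk_add (f g : ℕ → k) : Seq.mk f + Seq.mk g = Seq.mk fun i => f i + g i := rfl

theorem Seq.mk_sum {ι : Type*} (s : Finset ι) (f : ι → ℕ → k) :
    ∑ j ∈ s, Seq.mk (f j) = Seq.mk fun i => ∑ j ∈ s, f j i := by
  simp only [← Seq.mkHom_apply, ← map_sum]
  congr 1
  ext i
  simp

theorem Seq.mk_one : Seq.mk (fun _ => (1 : k)) = 1 := rfl

theorem Seq.mk_zero : Seq.mk (fun _ => (0 : k)) = 0 := rfl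

theorem shiftSeq_injective : Function.Injective (shiftSeq k) := by
  intro x y h
  obtain ⟨f, rfl⟩ := x.exists_mk
  obtain ⟨g, rfl⟩ := y.exists_mk
  rw [shiftSeq_mk, shiftSeq_mk, Seq.mk_eq_mk] at h
  rw [Seq.mk_eq_mk]
  obtain ⟨N, hN⟩ := eventually_atTop.1 h
  filter_upwards [eventually_ge_atTop (N + 1)] with i hi
  have := hN (i - 1) (by omega)
  rwa [show i - 1 + 1 = i by omega] at this

theorem shiftSeq_iterate_mk (f : ℕ → k) (n : ℕ) :
    (shiftSeq k)^[n] (Seq.mk f) = Seq.mk fun i => f (i + n) := by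
  induction n generalizing f with
  | zero => rfl
  | succ n ih =>
    rw [Function.iterate_succ_apply, shiftSeq_mk, ih]
    simp only [add_assoc]

/-- This rules out new constants in every shift-stable subring of `Seq k`, and makes variation of
constants work. -/
theorem exists_eq_const_of_shiftSeq_eq {x : Seq k} (hx : shiftSeq k x = x) :
    ∃ c : k, x = Seq.mk fun _ => c := by
  obtain ⟨f, rfl⟩ := x.exists_mk
  rw [shiftSeq_mk, Seq.mk_eq_mk] at hx
  obtain ⟨N, hN⟩ := eventually_atTop.1 hx
  refine ⟨f N, Seq.mk_eq_mk.2 (eventually_atTop.2 ⟨N, fun i hi => ?_⟩)⟩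
  induction i, hi using Nat.le_induction with
  | base => rfl
  | succ i hi ih => rw [hN i hi, ih]

/-- The zero set of a sequence is eventually periodic. -/
def Seq.PeriodicZeros (x : Seq k) : Prop :=
  ∀ f : ℕ → k, Seq.mk f = x → EventuallyPeriodic {i | f i = 0}

theorem Seq.periodicZeros_mk {f : ℕ → k} :
    (Seq.mk f).PeriodicZeros ↔ EventuallyPeriodic {i | f i = 0} := by
  refine ⟨fun h => h f rfl, fun h g hg => h.congr ?_⟩
  filter_upwards [Seq.mk_eq_mk.1 hg] with i hi
  simp [hi]

/-- The indicator sequence of the support of a sequence. -/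
def Seq.support (x : Seq k) : Seq k :=
  open Classical in Germ.map (fun a : k => if a = 0 then 0 else 1) x

open Classical in
theorem Seq.support_mk (f : ℕ → k) :
    (Seq.mk f).support = Seq.mk fun i => if f i = 0 then 0 else 1 := rfl

theorem Seq.support_mul (x y : Seq k) : (x * y).support = x.support * y.support := by
  classical
  obtain ⟨f, rfl⟩ := x.exists_mk
  obtain ⟨g, rfl⟩ := y.exists_mk
  simp only [mk_mul, support_mk]
  refine Seq.mk_eq_mk.2 (Eventually.of_forall fun i => ?_)
  by_cases h : f i = 0 <;> simp [h]

theorem Seq.support_one : (1 : Seq k).support = 1 := by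
  classical
  rw [← mk_one, support_mk]
  exact Seq.mk_eq_mk.2 (Eventually.of_forall fun i => by simp)

theorem Seq.support_zero : (0 : Seq k).support = 0 := by
  classical
  rw [← mk_zero, support_mk]
  exact Seq.mk_eq_mk.2 (Eventually.of_forall fun i => by simp)

theorem Seq.support_mul_self (x : Seq k) : x.support * x = x := by
  classical
  obtain ⟨f, rfl⟩ := x.exists_mk
  simp only [mk_mul, support_mk]
  refine Seq.mk_eq_mk.2 (Eventually.of_forall fun i => ?_)
  by_cases h : f i = 0 <;> simp [h]

theorem Seq.support_prod {ι : Type*} (s : Finset ι) (x : ι → Seq k) :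
    (∏ j ∈ s, x j).support = ∏ j ∈ s, (x j).support := by
  classical
  induction s using Finset.induction_on with
  | empty => simpa using support_one
  | insert j s hj ih => rw [Finset.prod_insert hj, Finset.prod_insert hj, support_mul, ih]

theorem Seq.shiftSeq_support (x : Seq k) : shiftSeq k x.support = (shiftSeq k x).support := by
  obtain ⟨f, rfl⟩ := x.exists_mk
  rfl

theorem Seq.isUnit_of_support_eq_one {x : Seq k} (h : x.support = 1) : IsUnit x := by
  classical
  obtain ⟨f, rfl⟩ := x.exists_mk
  refine IsUnit.of_mul_eq_one (Seq.mk fun i => (f i)⁻¹) ?_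
  rw [support_mk, ← mk_one, Seq.mk_eq_mk] at h
  rw [mk_mul, ← mk_one, Seq.mk_eq_mk]
  filter_upwards [h] with i hi
  by_cases h0 : f i = 0
  · simp [h0] at hi
  · simp [h0]

/-! ### Indicators of residue classes -/

/-- The indicator sequence of the `i` with `i + c = 0` modulo `l`. -/
def ind (k : Type*) [Field k] (l : ℕ) (c : ZMod l) : Seq k :=
  open Classical in Seq.mk fun i => if (i : ZMod l) + c = 0 then 1 else 0

/-- The condition `i + c = 0` in `ind`, rather than `i = c`, is what makes the shift raise the
index, as the definition of a pseudo field demands. -/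
theorem shiftSeq_ind (l : ℕ) (c : ZMod l) : shiftSeq k (ind k l c) = ind k l (c + 1) := by
  refine Seq.mk_eq_mk.2 (Eventually.of_forall fun i => ?_)
  simp only [Function.comp_apply, Nat.cast_add, Nat.cast_one, add_assoc, add_comm (1 : ZMod l)]

theorem ind_mul_self (l : ℕ) (c : ZMod l) : ind k l c * ind k l c = ind k l c :=
  Seq.mk_eq_mk.2 (Eventually.of_forall fun i => by simp)

theorem ind_mul_ind_of_ne {l m : ℕ} (hml : m ∣ l) {c : ZMod l} {d : ZMod m}
    (h : ZMod.castHom hml (ZMod m) c ≠ d) : ind k l c * ind k m d = 0 := by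
  refine Seq.mk_eq_mk.2 (Eventually.of_forall fun i => ?_)
  by_cases hc : (i : ZMod l) + c = 0
  · have h1 : (i : ZMod m) + ZMod.castHom hml (ZMod m) c = 0 := by
      have := congrArg (ZMod.castHom hml (ZMod m)) hc
      rwa [map_add, map_natCast, map_zero] at this
    have h2 : (i : ZMod m) + d ≠ 0 := fun h2 => h (add_left_cancel (h1.trans h2.symm))
    simp [h2]
  · simp [hc]

theorem ind_mul_ind_castHom {l m : ℕ} (hml : m ∣ l) (c : ZMod l) :
    ind k l c * ind k m (ZMod.castHom hml (ZMod m) c) = ind k l c := by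
  refine Seq.mk_eq_mk.2 (Eventually.of_forall fun i => ?_)
  by_cases hc : (i : ZMod l) + c = 0
  · have h1 : (i : ZMod m) + ZMod.castHom hml (ZMod m) c = 0 := by
      have := congrArg (ZMod.castHom hml (ZMod m)) hc
      rwa [map_add, map_natCast, map_zero] at this
    simp only [h1, hc, if_true, mul_one]
  · simp [hc]

theorem ind_mul_ind_same {l : ℕ} {c d : ZMod l} (h : c ≠ d) : ind k l c * ind k l d = 0 :=
  ind_mul_ind_of_ne dvd_rfl (by simpa using h)

theorem sum_ind (l : ℕ) [NeZero l] : ∑ c, ind k l c = 1 := by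
  classical
  unfold ind
  rw [Seq.mk_sum]
  refine Seq.mk_eq_mk.2 (Eventually.of_forall fun i => ?_)
  simp only [add_eq_zero_iff_neg_eq, Finset.sum_ite_eq, Finset.mem_univ, if_true]

theorem support_ind (l : ℕ) (c : ZMod l) : (ind k l c).support = ind k l c :=
  Seq.mk_eq_mk.2 (Eventually.of_forall fun i => by
    by_cases h : (i : ZMod l) + c = 0 <;> simp [h])

theorem ind_ne_zero (l : ℕ) [NeZero l] (c : ZMod l) : ind k l c ≠ 0 := by
  intro h
  obtain ⟨N, hN⟩ := eventually_atTop.1 (Seq.mk_eq_mk.1 (h.trans Seq.mk_zero.symm))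
  have := hN ((-c).val + l * N) (by nlinarith [NeZero.pos l])
  simp at this

theorem eq_of_forall_mul_ind {l : ℕ} [NeZero l] {x y : Seq k}
    (h : ∀ c, x * ind k l c = y * ind k l c) : x = y := by
  rw [← mul_one x, ← mul_one y, ← sum_ind l, Finset.mul_sum, Finset.mul_sum]
  exact Finset.sum_congr rfl fun c _ => h c

theorem eq_of_forall_mul_ind_of_dvd {l m : ℕ} [NeZero l] (hml : m ∣ l) {c : ZMod m} {x y : Seq k}
    (h : ∀ d : ZMod l, ZMod.castHom hml (ZMod m) d = c → x * ind k l d = y * ind k l d) :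
    x * ind k m c = y * ind k m c := by
  refine eq_of_forall_mul_ind (l := l) fun d => ?_
  rw [mul_assoc, mul_assoc, mul_comm (ind k m c)]
  by_cases hd : ZMod.castHom hml (ZMod m) d = c
  · subst hd
    rw [ind_mul_ind_castHom, h d rfl]
  · rw [ind_mul_ind_of_ne hml hd, mul_zero, mul_zero]

theorem mul_ind_eq_zero_of_dvd {l m : ℕ} (hml : m ∣ l) {d : ZMod l} {x : Seq k}
    (h : x * ind k m (ZMod.castHom hml (ZMod m) d) = 0) : x * ind k l d = 0 := by
  rw [← ind_mul_ind_castHom hml d, mul_left_comm, h, mul_zero]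

/-- On each residue class modulo `l`, the sequence `x` is eventually zero or eventually
nonzero. -/
def Seq.Dichotomy (x : Seq k) (l : ℕ) : Prop :=
  ∀ c : ZMod l, x * ind k l c = 0 ∨ x.support * ind k l c = ind k l c

theorem Seq.PeriodicZeros.exists_dichotomy {x : Seq k} (hx : x.PeriodicZeros) :
    ∃ l, 0 < l ∧ x.Dichotomy l := by
  classical
  obtain ⟨f, rfl⟩ := x.exists_mk
  obtain ⟨l, hl, h⟩ := hx f rfl
  obtain ⟨N, hN⟩ := exists_forall_modEq h
  have : NeZero l := ⟨hl.ne'⟩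
  refine ⟨l, hl, fun c => ?_⟩
  have hi₀ : (-c).val + l * N ≥ N := by nlinarith
  have key : ∀ i ≥ N, (i : ZMod l) + c = 0 → (f i = 0 ↔ f ((-c).val + l * N) = 0) := by
    intro i hi hc
    refine hN i hi _ hi₀ ((ZMod.natCast_eq_natCast_iff _ _ _).1 ?_)
    simpa using eq_neg_of_add_eq_zero_left hc
  by_cases h0 : f ((-c).val + l * N) = 0
  · left
    refine Seq.mk_eq_mk.2 (eventually_atTop.2 ⟨N, fun i hi => ?_⟩)
    by_cases hc : (i : ZMod l) + c = 0
    · simp [(key i hi hc).2 h0]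
    · simp [hc]
  · right
    refine Seq.mk_eq_mk.2 (eventually_atTop.2 ⟨N, fun i hi => ?_⟩)
    by_cases hc : (i : ZMod l) + c = 0
    · have h1 : f i ≠ 0 := fun h => h0 ((key i hi hc).1 h)
      simp [h1]
    · simp [hc]

theorem Seq.Dichotomy.of_dvd {x : Seq k} {l m : ℕ} (hml : m ∣ l) (h : x.Dichotomy m) :
    x.Dichotomy l := by
  intro d
  refine (h (ZMod.castHom hml (ZMod m) d)).imp (mul_ind_eq_zero_of_dvd hml) fun h => ?_
  rw [← ind_mul_ind_castHom hml d, mul_left_comm, h]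

end Seq

/-! ### Linear recurrences and finite-dimensional shift-stable spaces -/

section Recurrences

variable {k : Type*} [Field k] [CharZero k]

theorem algebraMap_eq_mk (h : RatFunc k) :
    algebraMap (RatFunc k) (Seq k) h = Seq.mk fun i => value h (i : k) := rfl

theorem algebraMap_C (c : k) :
    algebraMap (RatFunc k) (Seq k) (RatFunc.C c) = Seq.mk fun _ => c := by
  simp only [algebraMap_eq_mk, value_C]

theorem shiftSeq_algebraMap (h : RatFunc k) :
    shiftSeq k (algebraMap (RatFunc k) (Seq k) h) = algebraMap _ _ (shiftRatFunc k h) := by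
  rw [algebraMap_eq_mk, shiftSeq_mk, algebraMap_eq_mk, Seq.mk_eq_mk]
  filter_upwards [eventually_value_translate 1 h] with i hi
  rw [← translate_one, hi, Nat.cast_add, Nat.cast_one]

theorem shiftSeq_smul (h : RatFunc k) (x : Seq k) :
    shiftSeq k (h • x) = shiftRatFunc k h • shiftSeq k x := by
  rw [Algebra.smul_def, map_mul, shiftSeq_algebraMap, Algebra.smul_def]

theorem shiftSeq_mem_span {s : Set (Seq k)}
    (hs : ∀ x ∈ s, shiftSeq k x ∈ Submodule.span (RatFunc k) s) :
    ∀ x ∈ Submodule.span (RatFunc k) s, shiftSeq k x ∈ Submodule.span (RatFunc k) s := by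
  intro x hx
  induction hx using Submodule.span_induction with
  | mem x hx => exact hs x hx
  | zero => rw [map_zero]; exact zero_mem _
  | add x y _ _ hx hy => rw [map_add]; exact add_mem hx hy
  | smul a x _ hx => rw [shiftSeq_smul]; exact Submodule.smul_mem _ _ hx

variable (k) in
/-- The algebra of those sequences that lie in a finite-dimensional shift-stable
`k(z)`-subspace. -/
def recurrent : Subalgebra (RatFunc k) (Seq k) where
  carrier := {x | ∃ V : Submodule (RatFunc k) (Seq k),
    V.FG ∧ (∀ v ∈ V, shiftSeq k v ∈ V) ∧ x ∈ V}
  add_mem' := by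
    rintro x y ⟨V, hV, hσV, hx⟩ ⟨W, hW, hσW, hy⟩
    refine ⟨V ⊔ W, hV.sup hW, fun v hv => ?_, Submodule.add_mem_sup hx hy⟩
    obtain ⟨a, ha, b, hb, rfl⟩ := Submodule.mem_sup.1 hv
    rw [map_add]
    exact Submodule.add_mem_sup (hσV a ha) (hσW b hb)
  mul_mem' := by
    rintro x y ⟨V, hV, hσV, hx⟩ ⟨W, hW, hσW, hy⟩
    refine ⟨V * W, hV.mul hW, fun v hv => ?_, Submodule.mul_mem_mul hx hy⟩
    induction hv using Submodule.mul_induction_on' with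
    | mem_mul_mem a ha b hb =>
      rw [map_mul]
      exact Submodule.mul_mem_mul (hσV a ha) (hσW b hb)
    | add a _ b _ ha hb => rw [map_add]; exact add_mem ha hb
  algebraMap_mem' h := by
    refine ⟨Submodule.span _ {1}, Submodule.fg_span_singleton 1, shiftSeq_mem_span ?_, ?_⟩
    · rintro _ rfl
      rw [map_one]
      exact Submodule.mem_span_singleton_self _
    · rw [Algebra.algebraMap_eq_smul_one]
      exact Submodule.smul_mem _ _ (Submodule.mem_span_singleton_self _)

theorem mem_recurrent_of_shiftSeq_eq {ι : Type*} [Finite ι] {v : ι → Seq k}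
    (h : ∀ i, shiftSeq k (v i) ∈ Submodule.span (RatFunc k) (Set.range v)) (i : ι) :
    v i ∈ recurrent k :=
  ⟨Submodule.span _ (Set.range v), Submodule.fg_span (Set.finite_range v),
    shiftSeq_mem_span (by rintro _ ⟨j, rfl⟩; exact h j), Submodule.subset_span ⟨i, rfl⟩⟩

theorem isSolution_iff {n : ℕ} {h : Fin n → RatFunc k} {f : ℕ → k} :
    IsSolution h f ↔ (shiftSeq k)^[n] (Seq.mk f) +
      ∑ j, h j • (shiftSeq k)^[(j : ℕ)] (Seq.mk f) = 0 := by
  simp only [shiftSeq_iterate_mk, Algebra.smul_def, algebraMap_eq_mk, Seq.mk_mul, Seq.mk_sum,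
    Seq.mk_add]
  rw [← Seq.mk_zero, Seq.mk_eq_mk]
  rfl

/-- The spans of the first `n` shifts form an ascending chain in a finite-dimensional space. Where
it stabilises, the `n`-th shift is a combination of the earlier ones, which is a monic recurrence.
-/
theorem exists_isSolution {f : ℕ → k} (hf : Seq.mk f ∈ recurrent k) :
    ∃ (n : ℕ) (h : Fin n → RatFunc k), IsSolution h f := by
  obtain ⟨V, hV, hσV, hx⟩ := hf
  have hmem : ∀ j, (shiftSeq k)^[j] (Seq.mk f) ∈ V := by
    intro j
    induction j with
    | zero => exact hx
    | succ j ih => rw [Function.iterate_succ_apply']; exact hσV _ ih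
  have : Module.Finite (RatFunc k) V := Module.Finite.iff_fg.2 hV
  let u : ℕ → V := fun j => ⟨(shiftSeq k)^[j] (Seq.mk f), hmem j⟩
  let W : ℕ →o Submodule (RatFunc k) V :=
    ⟨fun n => Submodule.span _ (Set.range fun j : Fin n => u j), by
      intro a b hab
      refine Submodule.span_mono ?_
      rintro _ ⟨j, rfl⟩
      exact ⟨Fin.castLE hab j, rfl⟩⟩
  obtain ⟨n, hn⟩ := monotone_stabilizes_iff_noetherian.2 inferInstance W
  have hu : u n ∈ W n := by
    rw [hn (n + 1) (Nat.le_succ n)]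
    exact Submodule.subset_span ⟨Fin.last n, rfl⟩
  obtain ⟨c, hc⟩ := (Submodule.mem_span_range_iff_exists_fun _).1 hu
  refine ⟨n, fun j => -c j, isSolution_iff.2 ?_⟩
  have hc' := congrArg (Subtype.val) hc
  simp only [AddSubmonoidClass.coe_finsetSum, SetLike.val_smul, u] at hc'
  simp only [neg_smul, Finset.sum_neg_distrib, hc', add_neg_cancel]

end Recurrences

/-! ### A uniform period, and elements supported on single residue classes -/

section Idempotents

theorem ZMod.induction_sub_one {l : ℕ} [NeZero l] {P : ZMod l → Prop} (c : ZMod l) (h : P c)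
    (hP : ∀ d, P d → P (d - 1)) (d : ZMod l) : P d := by
  have key : ∀ j : ℕ, P (c - j) := by
    intro j
    induction j with
    | zero => simpa using h
    | succ j ih =>
      rw [Nat.cast_add, Nat.cast_one, ← sub_sub]
      exact hP _ ih
  have := key (c - d).val
  rwa [ZMod.natCast_zmod_val, sub_sub_cancel] at this

/-- Bézout: modulo `l`, the gcd of `t` and `l` is a multiple of `t`. -/
theorem ZMod.exists_eq_natCast_mul {l : ℕ} [NeZero l] (t a : ZMod l)
    (h : ZMod.castHom (Nat.gcd_dvd_right t.val l) (ZMod (t.val.gcd l)) a = 0) :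
    ∃ j : ℕ, a = j * t := by
  rw [← ZMod.natCast_zmod_val a, map_natCast, ZMod.natCast_eq_zero_iff] at h
  obtain ⟨q, hq⟩ := h
  have hg := congrArg (Int.cast : ℤ → ZMod l) (Nat.gcd_eq_gcd_ab t.val l)
  push_cast at hg
  rw [ZMod.natCast_self, zero_mul, add_zero, ZMod.natCast_zmod_val] at hg
  refine ⟨((t.val.gcdA l : ZMod l) * q).val, ?_⟩
  rw [ZMod.natCast_zmod_val, ← ZMod.natCast_zmod_val a, hq, Nat.cast_mul, hg]
  ring

variable {k : Type*} [Field k]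

theorem shiftSeq_mul_ind {l : ℕ} (x : Seq k) (c : ZMod l) :
    shiftSeq k x * ind k l c = shiftSeq k (x * ind k l (c - 1)) := by
  rw [map_mul, shiftSeq_ind, sub_add_cancel]

theorem shiftSeq_mul_ind_eq_zero_iff {l : ℕ} (x : Seq k) (c : ZMod l) :
    shiftSeq k x * ind k l c = 0 ↔ x * ind k l (c - 1) = 0 := by
  rw [shiftSeq_mul_ind, map_eq_zero_iff _ shiftSeq_injective]

/-- The ideal of the elements of `R` that eventually vanish on a residue class. -/
def vanishingIdeal (R : Subring (Seq k)) (l : ℕ) (c : ZMod l) : Ideal R where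
  carrier := {x | (x : Seq k) * ind k l c = 0}
  zero_mem' := zero_mul _
  add_mem' {x y} hx hy := by
    change ((x : Seq k) + y) * ind k l c = 0
    rw [add_mul, show (x : Seq k) * ind k l c = 0 from hx,
      show (y : Seq k) * ind k l c = 0 from hy, add_zero]
  smul_mem' a x hx := by
    change ((a : Seq k) * x) * ind k l c = 0
    rw [mul_assoc, show (x : Seq k) * ind k l c = 0 from hx, mul_zero]

/-- Passing to a smaller residue class enlarges the vanishing ideal. For a maximal vanishing ideal,
refining its class gives nothing new, so an element outside it vanishes on no subclass and hence is
eventually nonzero on the class. Shift-stability carries this to the other classes. -/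
theorem exists_forall_dichotomy (R : Subring (Seq k)) [IsNoetherianRing R]
    (hσ : ∀ x ∈ R, shiftSeq k x ∈ R) (hR : ∀ x ∈ R, x.PeriodicZeros) :
    ∃ l, 0 < l ∧ ∀ x ∈ R, x.Dichotomy l := by
  obtain ⟨_, ⟨l, c, hl, rfl⟩, hmax⟩ := set_has_maximal_iff_noetherian.2
    (inferInstance : IsNoetherian R R)
    {I | ∃ (l : ℕ) (c : ZMod l), 0 < l ∧ I = vanishingIdeal R l c}
    ⟨_, 1, 0, one_pos, rfl⟩
  have : NeZero l := ⟨hl.ne'⟩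
  refine ⟨l, hl, fun x hx d => ?_⟩
  revert x
  refine ZMod.induction_sub_one (P := fun d => ∀ x ∈ R, x * ind k l d = 0 ∨
    x.support * ind k l d = ind k l d) c ?_ ?_ d
  · intro x hx
    refine or_iff_not_imp_left.2 fun hxc => ?_
    -- The period `m` depends on `x`; on each class modulo `l * m` inside `c`, vanishing of `x`
    -- would by maximality force `x` to vanish on all of `c`.
    obtain ⟨m, hm, hxm⟩ := (hR x hx).exists_dichotomy
    have hlm : 0 < l * m := Nat.mul_pos hl hm
    have : NeZero (l * m) := ⟨hlm.ne'⟩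
    nth_rewrite 2 [← one_mul (ind k l c)]
    refine eq_of_forall_mul_ind_of_dvd (Dvd.intro m rfl) fun d hd => ?_
    rw [one_mul]
    refine (hxm.of_dvd (Dvd.intro_left l rfl) d).resolve_left fun h => hxc ?_
    have hle : vanishingIdeal R l c ≤ vanishingIdeal R (l * m) d := fun y hy =>
      mul_ind_eq_zero_of_dvd (Dvd.intro m rfl) (by rw [hd]; exact hy)
    have heq := hle.eq_of_not_lt (hmax _ ⟨_, d, hlm, rfl⟩)
    have hmem : (⟨x, hx⟩ : R) ∈ vanishingIdeal R (l * m) d := h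
    rwa [← heq] at hmem
  · intro d hd x hx
    refine (hd _ (hσ x hx)).imp (shiftSeq_mul_ind_eq_zero_iff x d).1 fun h => ?_
    apply shiftSeq_injective
    rw [← shiftSeq_mul_ind, Seq.shiftSeq_support, h, shiftSeq_ind, sub_add_cancel]

/-- Take the least `l` with the dichotomy. If vanishing on `c` implied vanishing on `c + t` with `t
≠ 0`, shift-stability would give this for every class, and iteration would identify classes
congruent modulo the gcd of `t` and `l`. That gcd would be a smaller admissible period. -/
theorem exists_forall_separating (R : Subring (Seq k)) [IsNoetherianRing R]
    (hσ : ∀ x ∈ R, shiftSeq k x ∈ R) (hR : ∀ x ∈ R, x.PeriodicZeros) :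
    ∃ l, 0 < l ∧ (∀ x ∈ R, x.Dichotomy l) ∧
      ∀ c d : ZMod l, c ≠ d → ∃ x ∈ R, x * ind k l c = 0 ∧ x * ind k l d ≠ 0 := by
  classical
  have hex := exists_forall_dichotomy R hσ hR
  obtain ⟨hl, hdich⟩ := Nat.find_spec hex
  have hmin : ∀ m < Nat.find hex, ¬ _ := fun m => Nat.find_min hex
  generalize Nat.find hex = l at hl hdich hmin
  have : NeZero l := ⟨hl.ne'⟩
  refine ⟨l, hl, hdich, fun c d hcd => ?_⟩
  by_contra! hcon
  set t := d - c with ht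
  have ht0 : t ≠ 0 := sub_ne_zero.2 hcd.symm
  have h1 : ∀ c', ∀ x ∈ R, x * ind k l c' = 0 → x * ind k l (c' + t) = 0 := by
    refine ZMod.induction_sub_one c (by simpa [ht] using hcon) fun c' h x hx h0 => ?_
    have := h _ (hσ x hx) ((shiftSeq_mul_ind_eq_zero_iff x c').2 h0)
    rwa [shiftSeq_mul_ind_eq_zero_iff, add_sub_right_comm] at this
  have h2 : ∀ c', ∀ x ∈ R, x * ind k l c' = 0 → ∀ j : ℕ, x * ind k l (c' + j * t) = 0 := by
    intro c' x hx h0 j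
    induction j with
    | zero => simpa using h0
    | succ j ih =>
      rw [Nat.cast_add, Nat.cast_one, add_mul, one_mul, ← add_assoc]
      exact h1 _ x hx ih
  have htpos : 0 < t.val := Nat.pos_of_ne_zero fun h => ht0 ((ZMod.val_eq_zero t).1 h)
  refine hmin (t.val.gcd l) ((Nat.gcd_le_left l htpos).trans_lt (ZMod.val_lt t))
    ⟨Nat.gcd_pos_of_pos_left l htpos, fun x hx a => ?_⟩
  have hdvd := Nat.gcd_dvd_right t.val l
  by_cases hc : ∃ c' : ZMod l, ZMod.castHom hdvd (ZMod (t.val.gcd l)) c' = a ∧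
      x * ind k l c' = 0
  · obtain ⟨c', hc', h0⟩ := hc
    left
    rw [← zero_mul (ind k (t.val.gcd l) a)]
    refine eq_of_forall_mul_ind_of_dvd hdvd fun b hb => ?_
    obtain ⟨j, hj⟩ := ZMod.exists_eq_natCast_mul t (b - c') (by rw [map_sub, hb, hc', sub_self])
    rw [zero_mul, eq_add_of_sub_eq' hj]
    exact h2 c' x hx h0 j
  · push Not at hc
    right
    nth_rewrite 2 [← one_mul (ind k (t.val.gcd l) a)]
    refine eq_of_forall_mul_ind_of_dvd hdvd fun b hb => ?_
    rw [one_mul]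
    exact (hdich x hx b).resolve_left (hc b hb)

/-- Elements of `R` whose supports are the residue classes modulo a suitable `l`. -/
theorem exists_support_eq_ind (R : Subring (Seq k)) [IsNoetherianRing R]
    (hσ : ∀ x ∈ R, shiftSeq k x ∈ R) (hR : ∀ x ∈ R, x.PeriodicZeros) :
    ∃ l, 0 < l ∧ (∀ x ∈ R, x.Dichotomy l) ∧
      ∀ c : ZMod l, ∃ x ∈ R, x.support = ind k l c := by
  classical
  obtain ⟨l, hl, hdich, hsep⟩ := exists_forall_separating R hσ hR
  have : NeZero l := ⟨hl.ne'⟩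
  refine ⟨l, hl, hdich, fun d => ?_⟩
  choose! x hxR hx0 hx1 using fun c => hsep c d
  -- The factor `x c` kills the class `c`, and by the dichotomy every factor is eventually nonzero
  -- on the class `d`.
  refine ⟨∏ c ∈ Finset.univ.erase d, x c,
    prod_mem fun c hc => hxR c (Finset.ne_of_mem_erase hc), ?_⟩
  rw [Seq.support_prod]
  refine eq_of_forall_mul_ind (l := l) fun c => ?_
  by_cases hcd : c = d
  · subst hcd
    rw [ind_mul_self]
    refine Finset.prod_induction (fun c' => (x c').support) (fun y => y * ind k l c = ind k l c)
      (fun a b ha hb => by rw [mul_assoc, hb, ha]) (one_mul _) fun c' hc' => ?_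
    have hne := Finset.ne_of_mem_erase hc'
    exact (hdich _ (hxR c' hne) c).resolve_left (hx1 c' hne)
  · rw [ind_mul_ind_same (Ne.symm hcd), ← Finset.mul_prod_erase (Finset.univ.erase d) _
      (Finset.mem_erase.2 ⟨hcd, Finset.mem_univ c⟩), mul_right_comm]
    have := congrArg Seq.support (hx0 c hcd)
    rw [Seq.support_mul, support_ind, Seq.support_zero] at this
    rw [this, zero_mul]

theorem isUnit_of_support_mul_ind {l : ℕ} [NeZero l] {x : Seq k}
    (h : ∀ c, x.support * ind k l c = ind k l c) : IsUnit x :=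
  Seq.isUnit_of_support_eq_one <| eq_of_forall_mul_ind fun c => by rw [one_mul, h c]

theorem mul_ind_of_support_eq {l : ℕ} {x : Seq k} {c : ZMod l} (h : x.support = ind k l c) :
    x * ind k l c = x := by
  rw [← h, mul_comm, Seq.support_mul_self]

theorem mul_ind_of_support_eq_of_ne {l : ℕ} {x : Seq k} {c d : ZMod l}
    (h : x.support = ind k l c) (hcd : c ≠ d) : x * ind k l d = 0 := by
  rw [← mul_ind_of_support_eq h, mul_assoc, ind_mul_ind_same hcd, mul_zero]

theorem sum_mul_ind_of_support_eq {l : ℕ} [NeZero l] {s : ZMod l → Seq k}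
    (hs : ∀ c, (s c).support = ind k l c) (c : ZMod l) : (∑ d, s d) * ind k l c = s c := by
  rw [Finset.sum_mul, Finset.sum_eq_single c
    (fun d _ hd => mul_ind_of_support_eq_of_ne (hs d) hd) (by simp), mul_ind_of_support_eq (hs c)]

theorem support_mul_ind (x : Seq k) {l : ℕ} (c : ZMod l) :
    x.support * ind k l c = (x * ind k l c).support := by
  rw [Seq.support_mul, support_ind]

theorem det_matrix_mk {n : ℕ} (M : ℕ → Matrix (Fin n) (Fin n) k) :
    (Matrix.of fun r s => Seq.mk fun i => M i r s).det = Seq.mk fun i => (M i).det := by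
  have h := (Seq.mkHom k).map_det (Matrix.of fun r s => fun i => M i r s)
  refine h.symm.trans (congrArg (Seq.mk) (funext fun i => ?_))
  exact (Pi.evalRingHom (fun _ : ℕ => k) i).map_det _

end Idempotents

/-! ### The ring of fractions inside `Seq k` is a pseudo field -/

section Fractions

variable {k : Type*} [Field k] [CharZero k]

/-- The fractions of elements of `R` in the ring of sequences. -/
def fractions (R : Subalgebra (RatFunc k) (Seq k)) : Subalgebra (RatFunc k) (Seq k) where
  carrier := {x | ∃ b ∈ R, IsUnit b ∧ x * b ∈ R}
  mul_mem' := by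
    rintro x y ⟨b, hb, hub, hxb⟩ ⟨c, hc, huc, hyc⟩
    refine ⟨b * c, mul_mem hb hc, hub.mul huc, ?_⟩
    rw [mul_mul_mul_comm]
    exact mul_mem hxb hyc
  add_mem' := by
    rintro x y ⟨b, hb, hub, hxb⟩ ⟨c, hc, huc, hyc⟩
    refine ⟨b * c, mul_mem hb hc, hub.mul huc, ?_⟩
    rw [show (x + y) * (b * c) = x * b * c + y * c * b by ring]
    exact add_mem (mul_mem hxb hc) (mul_mem hyc hb)
  algebraMap_mem' h := ⟨1, one_mem _, isUnit_one, by
    rw [mul_one]; exact R.algebraMap_mem h⟩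

theorem le_fractions (R : Subalgebra (RatFunc k) (Seq k)) : R ≤ fractions R := fun x hx =>
  ⟨1, one_mem _, isUnit_one, by rwa [mul_one]⟩

theorem isUnit_fractions {R : Subalgebra (RatFunc k) (Seq k)} {x : fractions R}
    (hx : IsUnit (x : Seq k)) : IsUnit x := by
  obtain ⟨b, hb, hub, hxb⟩ := x.2
  obtain ⟨c, hc⟩ := (hx.mul hub).exists_right_inv
  refine IsUnit.of_mul_eq_one ⟨b * c, x * b, hxb, hx.mul hub, ?_⟩ (Subtype.ext ?_)
  · rw [show b * c * (x * b) = b * (x * b * c) by ring, hc, mul_one]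
    exact hb
  · simpa [mul_assoc] using hc

theorem shiftSeq_mem_fractions {R : Subalgebra (RatFunc k) (Seq k)}
    (hσ : ∀ x ∈ R, shiftSeq k x ∈ R) : ∀ x ∈ fractions R, shiftSeq k x ∈ fractions R := by
  rintro x ⟨b, hb, hub, hxb⟩
  exact ⟨_, hσ b hb, hub.map _, by rw [← map_mul]; exact hσ _ hxb⟩

/-- With `s c` supported on the class `c`, the sum of all `s d` is a unit of `Seq k`, and the
indicator is `s c` divided by this sum. -/
theorem ind_mem_fractions {R : Subalgebra (RatFunc k) (Seq k)} {l : ℕ} [NeZero l]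
    (hs : ∀ c : ZMod l, ∃ x ∈ R, x.support = ind k l c) (c : ZMod l) :
    ind k l c ∈ fractions R := by
  choose s hsR hs using hs
  refine ⟨∑ d, s d, sum_mem fun d _ => hsR d, isUnit_of_support_mul_ind (l := l) fun d => ?_, ?_⟩
  · rw [support_mul_ind, sum_mul_ind_of_support_eq hs, hs]
  · rw [mul_comm, sum_mul_ind_of_support_eq hs]
    exact hsR c

theorem exists_inverse_on_class {R : Subalgebra (RatFunc k) (Seq k)} {l : ℕ} [NeZero l]
    (hdich : ∀ x ∈ R, x.Dichotomy l) (hs : ∀ c : ZMod l, ∃ x ∈ R, x.support = ind k l c)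
    (c : ZMod l) {x : Seq k} (hxF : x ∈ fractions R) (hx : ind k l c * x ≠ 0) :
    ∃ y ∈ fractions R, ind k l c * x * (ind k l c * y) = ind k l c := by
  choose s hsR hs using hs
  obtain ⟨b, hb, hub, hxb⟩ := hxF
  have ha : (x * b).support * ind k l c = ind k l c := by
    refine (hdich _ hxb c).resolve_left fun h => hx (hub.mul_left_injective ?_)
    simp only [zero_mul]
    rw [← h]
    ring
  set S := ∑ d, s d with hS
  have hSR : S ∈ R := sum_mem fun d _ => hsR d
  -- A denominator in `R` that equals `x * b * s c` on the class `c` and is filled up by the other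
  -- `s c'` elsewhere, hence a unit; the inverse of `x` on `c` is then `b * s c / d`.
  set d := x * b * s c + (S - s c) with hd
  have hdR : d ∈ R := add_mem (mul_mem hxb (hsR c)) (sub_mem hSR (hsR c))
  have hdc : d * ind k l c = x * b * s c := by
    rw [hd, add_mul, sub_mul, hS, sum_mul_ind_of_support_eq hs, mul_ind_of_support_eq (hs c),
      sub_self, add_zero, mul_assoc, mul_ind_of_support_eq (hs c)]
  have hdunit : IsUnit d := isUnit_of_support_mul_ind (l := l) fun c' => by
    rw [support_mul_ind]
    by_cases hc' : c = c'
    · subst hc'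
      rw [hdc, Seq.support_mul, hs, ha]
    · rw [hd, add_mul, sub_mul, mul_assoc, mul_ind_of_support_eq_of_ne (hs c) hc', mul_zero,
        zero_add, sub_zero, hS, sum_mul_ind_of_support_eq hs, hs]
  obtain ⟨d', hd'⟩ := hdunit.exists_right_inv
  refine ⟨b * s c * d', ⟨d, hdR, hdunit, ?_⟩, ?_⟩
  · rw [mul_assoc, mul_comm d', hd', mul_one]
    exact mul_mem hb (hsR c)
  · calc _ = ind k l c * ind k l c * (x * b * s c) * d' := by ring
      _ = ind k l c * ind k l c * ind k l c * (d * d') := by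
        rw [← hdc]; ring
      _ = _ := by rw [ind_mul_self, ind_mul_self, hd', mul_one]

theorem isPseudoField_fractions {R : Subalgebra (RatFunc k) (Seq k)}
    (hσ : ∀ x ∈ R, shiftSeq k x ∈ R) {m : ℕ} (hdich : ∀ x ∈ R, x.Dichotomy (m + 1))
    (hs : ∀ c : ZMod (m + 1), ∃ x ∈ R, x.support = ind k (m + 1) c) :
    IsPseudoField ((shiftSeq k).restrict (fractions R) (fractions R)
      (shiftSeq_mem_fractions hσ)) := by
  have hcomplete : CompleteOrthogonalIdempotents fun c : ZMod (m + 1) =>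
      (⟨ind k (m + 1) c, ind_mem_fractions hs c⟩ : fractions R) := by
    refine ⟨⟨fun c => Subtype.ext (ind_mul_self _ c),
      fun c d hcd => Subtype.ext (ind_mul_ind_same hcd)⟩, Subtype.ext ?_⟩
    rw [AddSubmonoidClass.coe_finsetSum]
    exact sum_ind (m + 1)
  refine ⟨m, _, hcomplete, fun c => Subtype.ext (shiftSeq_ind (m + 1) c), fun c => ⟨fun h => ?_,
    fun x hx => ?_⟩⟩
  · exact ind_ne_zero (m + 1) c (congrArg Subtype.val h)
  · obtain ⟨y, hy, h⟩ := exists_inverse_on_class hdich hs c x.2 fun h => hx (Subtype.ext h)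
    exact ⟨⟨y, hy⟩, Subtype.ext h⟩

theorem isFractionRing_fractions {R : Subalgebra (RatFunc k) (Seq k)} {l : ℕ} [NeZero l]
    (hdich : ∀ x ∈ R, x.Dichotomy l) (hs : ∀ c : ZMod l, ∃ x ∈ R, x.support = ind k l c)
    (T : Subalgebra (RatFunc k) (fractions R)) (hT : T.map (fractions R).val = R) :
    IsFractionRing T (fractions R) := by
  have hTR : ∀ x : T, ((x : fractions R) : Seq k) ∈ R := fun x => by
    have : ((x : fractions R) : Seq k) ∈ T.map (fractions R).val := ⟨x, x.2, rfl⟩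
    rwa [hT] at this
  have hRT : ∀ x ∈ R, ∃ y : T, ((y : fractions R) : Seq k) = x := fun x hx => by
    rw [← hT] at hx
    obtain ⟨y, hy, rfl⟩ := hx
    exact ⟨⟨y, hy⟩, rfl⟩
  have hinj : ∀ x y : T, ((x : fractions R) : Seq k) = y → x = y := fun x y h =>
    Subtype.ext (Subtype.ext h)
  refine { map_units := fun x => ?_, surj := fun x => ?_, exists_of_eq := fun {x y} h => ?_ }
  · refine isUnit_fractions (Seq.isUnit_of_support_eq_one ?_)
    refine eq_of_forall_mul_ind (l := l) fun c => ?_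
    rw [one_mul]
    -- An element vanishing on a whole class is a zero divisor: it is killed by the element of `R`
    -- supported there.
    refine (hdich _ (hTR x) c).resolve_left fun h => ?_
    obtain ⟨s, hsR, hs⟩ := hs c
    obtain ⟨s, rfl⟩ := hRT s hsR
    have h0 : (x : T) * s = 0 := by
      refine hinj _ _ ?_
      change ((x : T) : Seq k) * s = 0
      rw [← Seq.support_mul_self (s : Seq k), hs, ← mul_assoc, h, zero_mul]
    have hs0 : s = 0 := (mul_left_mem_nonZeroDivisors_eq_zero_iff x.2).1 h0
    rw [hs0] at hs
    exact ind_ne_zero l c (hs.symm.trans Seq.support_zero)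
  · obtain ⟨b, hb, hub, hxb⟩ := x.2
    obtain ⟨b, rfl⟩ := hRT b hb
    obtain ⟨a, ha⟩ := hRT _ hxb
    refine ⟨(a, ⟨b, mem_nonZeroDivisors_of_injective (f := algebraMap T (fractions R))
      Subtype.val_injective (isUnit_fractions hub).mem_nonZeroDivisors⟩), Subtype.ext ha.symm⟩
  · exact ⟨1, by rw [Subtype.val_injective h]⟩

end Fractions

/-! ### Construction of a Picard–Vessiot extension -/

section Existence

variable {k : Type*} [Field k] [CharZero k] {n : ℕ}

/-- The determinant of the image of `A` over `Seq k` is a unit there, and a unit class of sequences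
is eventually nonzero. -/
theorem eventually_det_valueMatrix (A : GL (Fin n) (RatFunc k)) :
    ∀ᶠ i : ℕ in atTop, (valueMatrix A (i : k)).det ≠ 0 := by
  have h1 : ((A : Matrix (Fin n) (Fin n) (RatFunc k)).map (algebraMap _ (Seq k))).det =
      Seq.mk fun i : ℕ => (valueMatrix A (i : k)).det := det_matrix_mk _
  have h2 : IsUnit ((A : Matrix (Fin n) (Fin n) (RatFunc k)).map (algebraMap _ (Seq k))).det := by
    have := (Matrix.isUnits_det_units A).map (algebraMap (RatFunc k) (Seq k))
    rwa [RingHom.map_det] at this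
  rw [h1] at h2
  obtain ⟨y, hy⟩ := h2.exists_right_inv
  obtain ⟨g, rfl⟩ := y.exists_mk
  filter_upwards [Seq.mk_eq_mk.1 hy] with i hi h0
  simp [h0] at hi

theorem eventually_regularAt_entries (A : GL (Fin n) (RatFunc k)) :
    ∀ᶠ i : ℕ in atTop, ∀ r s,
      RegularAt ((A : Matrix (Fin n) (Fin n) (RatFunc k)) r s) (i : k) :=
  eventually_all.2 fun _ => eventually_all.2 fun _ => eventually_regularAt _

theorem exists_fundamental_sequence (A : GL (Fin n) (RatFunc k)) :
    ∃ M : ℕ → Matrix (Fin n) (Fin n) k, (∀ i, (M i).det ≠ 0) ∧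
      ∀ᶠ i : ℕ in atTop, M (i + 1) = valueMatrix A (i : k) * M i := by
  classical
  -- Replacing the finitely many singular values of `A` by the identity keeps all products
  -- invertible and does not affect the recurrence for large indices.
  let P : ℕ → Matrix (Fin n) (Fin n) k := fun i =>
    if (valueMatrix A (i : k)).det ≠ 0 then valueMatrix A (i : k) else 1
  let M : ℕ → Matrix (Fin n) (Fin n) k := fun i => Nat.rec 1 (fun j m => P j * m) i
  have hM : ∀ i, M (i + 1) = P i * M i := fun _ => rfl
  refine ⟨M, fun i => ?_, ?_⟩
  · induction i with
    | zero => simp [M]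
    | succ i ih =>
      rw [hM, Matrix.det_mul]
      refine mul_ne_zero ?_ ih
      by_cases h : (valueMatrix A (i : k)).det = 0 <;> simp [P, h]
  · filter_upwards [eventually_det_valueMatrix A] with i hi
    rw [hM]
    simp only [P, if_pos hi]

theorem map_shiftSeq_matrix_mk {A : GL (Fin n) (RatFunc k)} {M : ℕ → Matrix (Fin n) (Fin n) k}
    (hM : ∀ᶠ i : ℕ in atTop, M (i + 1) = valueMatrix A (i : k) * M i) :
    (Matrix.of fun r s => Seq.mk fun i => M i r s).map (shiftSeq k) =
      (A : Matrix (Fin n) (Fin n) (RatFunc k)).map (algebraMap _ (Seq k)) *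
        Matrix.of fun r s => Seq.mk fun i => M i r s := by
  ext r s
  rw [Matrix.map_apply, Matrix.of_apply, shiftSeq_mk, Matrix.mul_apply]
  simp only [Matrix.map_apply, Matrix.of_apply, algebraMap_eq_mk, Seq.mk_mul, Seq.mk_sum]
  rw [Seq.mk_eq_mk]
  filter_upwards [hM] with i hi
  rw [hi, Matrix.mul_apply]
  rfl

theorem mem_recurrent_of_map_shiftSeq_eq {A : GL (Fin n) (RatFunc k)}
    {M : Matrix (Fin n) (Fin n) (Seq k)}
    (hM : M.map (shiftSeq k) =
      (A : Matrix (Fin n) (Fin n) (RatFunc k)).map (algebraMap _ (Seq k)) * M) (r s : Fin n) :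
    M r s ∈ recurrent k := by
  refine mem_recurrent_of_shiftSeq_eq (v := fun p : Fin n × Fin n => M p.1 p.2) (fun p => ?_)
    (r, s)
  have := congrFun (congrFun hM p.1) p.2
  rw [Matrix.map_apply, Matrix.mul_apply] at this
  rw [this]
  refine sum_mem fun j _ => ?_
  rw [Matrix.map_apply, ← Algebra.smul_def]
  exact Submodule.smul_mem _ _ (Submodule.subset_span ⟨(j, p.2), rfl⟩)

theorem shiftSeq_mem_adjoin {s : Set (Seq k)}
    (hs : ∀ x ∈ s, shiftSeq k x ∈ Algebra.adjoin (RatFunc k) s) :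
    ∀ x ∈ Algebra.adjoin (RatFunc k) s, shiftSeq k x ∈ Algebra.adjoin (RatFunc k) s := by
  intro x hx
  induction hx using Algebra.adjoin_induction with
  | mem x hx => exact hs x hx
  | algebraMap h => rw [shiftSeq_algebraMap]; exact Subalgebra.algebraMap_mem _ _
  | add x y _ _ hx hy => rw [map_add]; exact add_mem hx hy
  | mul x y _ _ hx hy => rw [map_mul]; exact mul_mem hx hy

theorem isNoetherianRing_adjoin {s : Set (Seq k)} (hs : s.Finite) :
    IsNoetherianRing (Algebra.adjoin (RatFunc k) s) := by
  obtain ⟨t, rfl⟩ := hs.exists_finset_coe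
  exact isNoetherianRing_of_fg (Subalgebra.fg_adjoin_finset t)

theorem hasPVExtensionInSeq_of_periodicZeros
    (hper : ∀ x ∈ recurrent k, x.PeriodicZeros) (A : GL (Fin n) (RatFunc k)) :
    HasPVExtensionInSeq A := by
  obtain ⟨P, hdet, hP⟩ := exists_fundamental_sequence A
  have hM := map_shiftSeq_matrix_mk hP
  have hMdet := det_matrix_mk P
  generalize Matrix.of (fun r s => Seq.mk fun i => P i r s) = M at hM hMdet
  have hMunit : IsUnit M.det := by
    rw [hMdet]
    refine IsUnit.of_mul_eq_one (Seq.mk fun i => ((P i).det)⁻¹) ?_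
    exact Seq.mk_eq_mk.2 (Eventually.of_forall fun i => mul_inv_cancel₀ (hdet i))
  set R := Algebra.adjoin (RatFunc k) (Set.range fun p : Fin n × Fin n => M p.1 p.2) with hR
  have hMR : ∀ r s, M r s ∈ R := fun r s => Algebra.subset_adjoin ⟨(r, s), rfl⟩
  have hRrec : R ≤ recurrent k := Algebra.adjoin_le (by
    rintro _ ⟨p, rfl⟩
    exact mem_recurrent_of_map_shiftSeq_eq hM _ _)
  have hσ : ∀ x ∈ R, shiftSeq k x ∈ R := by
    refine shiftSeq_mem_adjoin ?_
    rintro _ ⟨p, rfl⟩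
    have := congrFun (congrFun hM p.1) p.2
    rw [Matrix.map_apply, Matrix.mul_apply] at this
    rw [this]
    exact sum_mem fun j _ => mul_mem (Subalgebra.algebraMap_mem _ _) (hMR _ _)
  have : IsNoetherianRing R.toSubring := isNoetherianRing_adjoin (Set.finite_range _)
  obtain ⟨l, hl, hdich, hs⟩ := exists_support_eq_ind R.toSubring hσ
    fun x hx => hper x (hRrec hx)
  -- Writing the period as a successor makes `ZMod` of it definitionally the index type `Fin (m +
  -- 1)` of `IsPseudoField`.
  obtain ⟨m, rfl⟩ := Nat.exists_eq_succ_of_ne_zero hl.ne'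
  let N : Matrix (Fin n) (Fin n) (fractions R) :=
    Matrix.of fun r s => ⟨M r s, le_fractions R (hMR r s)⟩
  have hNM : N.map (fractions R).val = M := rfl
  have hN : IsUnit N.det := by
    refine isUnit_fractions ?_
    change IsUnit ((fractions R).val N.det)
    rw [AlgHom.map_det]
    exact hMunit
  refine ⟨fractions R, shiftSeq_mem_fractions hσ, fun h => Subtype.ext (shiftSeq_algebraMap h),
    isPseudoField_fractions hσ hdich hs, ⟨Matrix.nonsingInvUnit N hN, ?_, ?_⟩,
    fun x => ⟨fun hx => ?_, ?_⟩⟩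
  · ext r s
    have h := congrFun (congrFun hM r) s
    rw [Matrix.map_apply, Matrix.mul_apply] at h
    rw [Matrix.map_apply, Matrix.mul_apply, AddSubmonoidClass.coe_finsetSum]
    exact h
  · refine isFractionRing_fractions hdich hs _ ?_
    rw [AlgHom.map_adjoin, ← Set.range_comp]
    rfl
  · obtain ⟨c, hc⟩ := exists_eq_const_of_shiftSeq_eq (congrArg Subtype.val hx)
    refine ⟨RatFunc.C c, ?_, Subtype.ext ((algebraMap_C c).trans hc.symm)⟩
    rw [← translate_one, ← RatFunc.algebraMap_C, translate_algebraMap, Polynomial.taylor_C]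
  · rintro ⟨c, hc, rfl⟩
    refine Subtype.ext ?_
    change shiftSeq k (algebraMap (RatFunc k) (Seq k) c) = _
    rw [shiftSeq_algebraMap, hc]
    rfl

end Existence

/-! ### Orbits of the rational map and solutions of linear systems -/

section Dynamics

variable {k : Type*} [Field k] {n : ℕ}

theorem step_fst {A : GL (Fin n) (RatFunc k)} {x : Pt k n} (h : x ∈ stepDomain A) :
    (step A x).1 = x.1 + 1 := by
  rw [step, dif_pos h]

theorem coe_step_snd {A : GL (Fin n) (RatFunc k)} {x : Pt k n} (h : x ∈ stepDomain A) :
    ((step A x).2 : Matrix (Fin n) (Fin n) k) = valueMatrix A x.1 * x.2 := by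
  rw [step, dif_pos h]
  rfl

theorem iterate_step_fst {A : GL (Fin n) (RatFunc k)} {x : Pt k n} (h : OrbitDefined A x)
    (i : ℕ) : ((step A)^[i] x).1 = i + x.1 := by
  induction i with
  | zero => simp
  | succ i ih =>
    rw [Function.iterate_succ_apply', step_fst (h i), ih]
    push_cast
    ring

/-- A closed subvariety is defined by finitely many polynomials. -/
theorem IsClosedSubvariety.exists_finset {Y : Set (Pt k n)} (hY : IsClosedSubvariety Y) :
    ∃ T : Finset (MvPolynomial (Option (Fin n × Fin n)) k),
      Y = {x | ∀ p ∈ T, MvPolynomial.eval (coords x) p = 0} := by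
  obtain ⟨S, rfl⟩ := hY
  obtain ⟨T, hTS, hT⟩ := Submodule.fg_span_iff_fg_span_finset_subset S |>.1
    (IsNoetherian.noetherian (Ideal.span S))
  refine ⟨T, Set.ext fun x => ⟨fun h p hp => h p (hTS hp), fun h p hp => ?_⟩⟩
  have hle : Ideal.span (T : Set (MvPolynomial (Option (Fin n × Fin n)) k)) ≤
      RingHom.ker (MvPolynomial.eval (coords x)) := Ideal.span_le.2 fun q hq => h q hq
  refine hle ?_
  change p ∈ Submodule.span _ _
  rw [← hT]
  exact Submodule.subset_span hp

theorem EventuallyPeriodic.forall_mem_finset {ι : Type*} (T : Finset ι) {S : ι → Set ℕ}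
    (h : ∀ p ∈ T, EventuallyPeriodic (S p)) : EventuallyPeriodic {i | ∀ p ∈ T, i ∈ S p} := by
  classical
  induction T using Finset.induction_on with
  | empty => exact .of_forall (by simp)
  | insert p T _ ih =>
    convert (h p (Finset.mem_insert_self _ _)).inter
      (ih fun q hq => h q (Finset.mem_insert_of_mem hq)) using 1
    ext i
    simp

variable [CharZero k]

theorem orbit_mem_recurrent {A : GL (Fin n) (RatFunc k)} {x : Pt k n} (h : OrbitDefined A x)
    (p : MvPolynomial (Option (Fin n × Fin n)) k) :
    Seq.mk (fun i => MvPolynomial.eval (coords ((step A)^[i] x)) p) ∈ recurrent k := by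
  induction p using MvPolynomial.induction_on with
  | C a =>
    simp only [MvPolynomial.eval_C]
    rw [← algebraMap_C]
    exact Subalgebra.algebraMap_mem _ _
  | add p q hp hq =>
    simp only [map_add]
    exact add_mem hp hq
  | mul_X p c hp =>
    simp only [map_mul, MvPolynomial.eval_X]
    refine (recurrent k).mul_mem hp (y := Seq.mk _) ?_
    rcases c with _ | ⟨r, s⟩
    · simp only [coords, iterate_step_fst h]
      have := Subalgebra.algebraMap_mem (recurrent k)
        (algebraMap (Polynomial k) (RatFunc k) (Polynomial.X + Polynomial.C x.1))
      rw [algebraMap_eq_mk] at this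
      simpa only [value_algebraMap, Polynomial.eval_add, Polynomial.eval_X,
        Polynomial.eval_C] using this
    -- The orbit starts at `z = x.1` and not at 0, so its matrix part solves the system of the
    -- translate of `A`.
    · have hM := map_shiftSeq_matrix_mk (A := Matrix.GeneralLinearGroup.map (translate x.1) A)
        (M := fun i => ((step A)^[i] x).2) ?_
      · exact mem_recurrent_of_map_shiftSeq_eq hM r s
      · have hval : ∀ᶠ i : ℕ in atTop, ∀ r s : Fin n,
            value (translate x.1 ((A : Matrix (Fin n) (Fin n) (RatFunc k)) r s)) (i : k) =
              value ((A : Matrix (Fin n) (Fin n) (RatFunc k)) r s) (i + x.1) :=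
          eventually_all.2 fun _ => eventually_all.2 fun _ => eventually_value_translate _ _
        filter_upwards [hval] with i hi
        rw [Function.iterate_succ_apply', coe_step_snd (h i), iterate_step_fst h]
        congr 1
        ext r s
        exact (hi r s).symm

theorem isFiniteUnionAP_orbit (hper : ∀ x ∈ recurrent k, x.PeriodicZeros)
    (A : GL (Fin n) (RatFunc k)) {Y : Set (Pt k n)} (hY : IsClosedSubvariety Y) {x : Pt k n}
    (hx : OrbitDefined A x) : IsFiniteUnionAP {i : ℕ | (step A)^[i] x ∈ Y} := by
  rw [isFiniteUnionAP_iff]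
  obtain ⟨T, rfl⟩ := hY.exists_finset
  exact EventuallyPeriodic.forall_mem_finset T
    (S := fun p => {i | MvPolynomial.eval (coords ((step A)^[i] x)) p = 0}) fun p _ =>
    Seq.periodicZeros_mk.1 (hper _ (orbit_mem_recurrent hx p))

variable (k) in
/-- The entries of the solutions in `Seq k` of all systems `σ(v) = A v` have eventually
periodic zero sets. -/
def SystemsHavePeriodicZeros : Prop :=
  ∀ (n : ℕ) (A : GL (Fin n) (RatFunc k)) (v : Fin n → Seq k),
    (∀ r, shiftSeq k (v r) = ∑ s, (A : Matrix (Fin n) (Fin n) (RatFunc k)) r s • v s) →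
      ∀ r, (v r).PeriodicZeros

theorem systemsHavePeriodicZeros_of_orbits
    (h : ∀ (n : ℕ) (A : GL (Fin n) (RatFunc k)) (Y : Set (Pt k n)), IsClosedSubvariety Y →
      ∀ x : Pt k n, OrbitDefined A x → IsFiniteUnionAP {i : ℕ | (step A)^[i] x ∈ Y}) :
    SystemsHavePeriodicZeros k := by
  intro n A v hv r
  choose g hg using fun r => (v r).exists_mk
  have hrec : ∀ᶠ i : ℕ in atTop, ∀ r, g r (i + 1) = ∑ s, valueMatrix A (i : k) r s * g s i := by
    refine eventually_all.2 fun r => ?_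
    have := hv r
    simp only [← hg, shiftSeq_mk, Algebra.smul_def, algebraMap_eq_mk, Seq.mk_mul,
      Seq.mk_sum] at this
    exact Seq.mk_eq_mk.1 this
  obtain ⟨N, hN⟩ := eventually_atTop.1
    ((eventually_regularAt_entries A).and ((eventually_det_valueMatrix A).and hrec))
  -- Beyond `N`, `A` has no poles and is invertible, so the orbit is defined. Its matrix part is the
  -- transition matrix from index `N` to `N + i`, and the zeros of `g r` are the visits to the locus
  -- where row `r` of the matrix pairs to zero with the initial vector at `N`.
  let x : Pt k n := ((N : k), 1)
  have key : ∀ i : ℕ, ((step A)^[i] x).1 = ((N + i : ℕ) : k) ∧ (∀ r, g r (N + i) =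
      ∑ s, (((step A)^[i] x).2 : Matrix (Fin n) (Fin n) k) r s * g s N) := by
    intro i
    induction i with
    | zero => simp [x, Matrix.one_apply]
    | succ i ih =>
      obtain ⟨h1, h2⟩ := ih
      obtain ⟨hreg, hdet, hr⟩ := hN (N + i) (by omega)
      have hmem : (step A)^[i] x ∈ stepDomain A := by
        refine ⟨fun r s => ?_, ?_⟩
        · rw [h1]; exact hreg r s
        · rw [h1]; exact hdet
      rw [Function.iterate_succ_apply']
      refine ⟨by rw [step_fst hmem, h1]; push_cast; ring, fun r => ?_⟩
      rw [coe_step_snd hmem, h1, ← add_assoc, hr r]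
      simp only [h2, Matrix.mul_apply, Finset.sum_mul, Finset.mul_sum, mul_assoc]
      exact Finset.sum_comm
  have hx : OrbitDefined A x := fun i => by
    obtain ⟨hreg, hdet, -⟩ := hN (N + i) (by omega)
    refine ⟨fun r s => ?_, ?_⟩
    · rw [(key i).1]; exact hreg r s
    · rw [(key i).1]; exact hdet
  rw [← hg r, Seq.periodicZeros_mk]
  refine EventuallyPeriodic.of_shift N ?_
  have := isFiniteUnionAP_iff.1 (h n A _
    ⟨{∑ s, MvPolynomial.X (some (r, s)) * MvPolynomial.C (g s N)}, rfl⟩ x hx)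
  convert this using 1
  ext i
  simp [coords, ← (key i).2 r, add_comm i N]

end Dynamics

/-! ### From pseudo fields to periodic zero sets -/

section PicardVessiot

variable {k : Type*} [Field k] [CharZero k]

/-- Each idempotent is fixed by a power of the shift, so its zeros are periodic. Its product with
`x` is either zero or invertible in the corresponding field, and then vanishes exactly where the
idempotent does. As the idempotents sum to 1, the zeros of `x` are the common zeros of these
products. -/
theorem periodicZeros_of_mem_pseudoField {R : Subring (Seq k)}
    (hR : ∀ x ∈ R, shiftSeq k x ∈ R) (hps : IsPseudoField ((shiftSeq k).restrict R R hR))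
    {x : Seq k} (hx : x ∈ R) : x.PeriodicZeros := by
  obtain ⟨m, e, he, hσ, hfield⟩ := hps
  let E : ZMod (m + 1) → Seq k := fun c => e c
  have hE : ∀ c, shiftSeq k (E c) = E (c + 1) := fun c => congrArg Subtype.val (hσ c)
  have hEit : ∀ (j : ℕ) c, (shiftSeq k)^[j] (E c) = E (c + j) := by
    intro j
    induction j with
    | zero => simp
    | succ j ih =>
      intro c
      rw [Function.iterate_succ_apply, hE, ih, Nat.cast_add, Nat.cast_one, add_right_comm,
        add_assoc]
  have hsum : ∑ c, E c = 1 := by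
    have := congrArg Subtype.val he.complete
    rw [AddSubmonoidClass.coe_finsetSum] at this
    exact this
  choose g hg using fun c => (E c).exists_mk
  obtain ⟨f, rfl⟩ := x.exists_mk
  rw [Seq.periodicZeros_mk]
  have hper : ∀ c, EventuallyPeriodic {i | g c i = 0} := by
    intro c
    refine ⟨m + 1, Nat.succ_pos m, ?_⟩
    have := hEit (m + 1) c
    rw [ZMod.natCast_self, add_zero, ← hg, shiftSeq_iterate_mk, Seq.mk_eq_mk] at this
    filter_upwards [this] with i hi
    simp [hi]
  have hper' : ∀ c, EventuallyPeriodic {i | g c i = 0 ∨ f i = 0} := by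
    intro c
    by_cases h0 : e c * ⟨Seq.mk f, hx⟩ = 0
    · have h1 : E c * Seq.mk f = 0 := congrArg Subtype.val h0
      rw [← hg, Seq.mk_mul, ← Seq.mk_zero, Seq.mk_eq_mk] at h1
      refine (EventuallyPeriodic.of_forall (S := Set.univ) fun _ => trivial).congr ?_
      filter_upwards [h1] with i hi
      simpa using hi
    · obtain ⟨y, hy⟩ := (hfield c).2 _ h0
      have h1 : E c * Seq.mk f * (E c * y) = E c := congrArg Subtype.val hy
      obtain ⟨q, hq⟩ := Seq.exists_mk (y : Seq k)
      rw [← hq, ← hg, Seq.mk_mul, Seq.mk_mul, Seq.mk_mul, Seq.mk_eq_mk] at h1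
      refine (hper c).congr ?_
      filter_upwards [h1] with i hi
      refine ⟨Or.inl, ?_⟩
      rintro (h | h)
      · exact h
      · simpa [h] using hi.symm
  refine (EventuallyPeriodic.forall_mem_finset Finset.univ fun c _ => hper' c).congr ?_
  simp only [← hg, Seq.mk_sum] at hsum
  filter_upwards [Seq.mk_eq_mk.1 (hsum.trans Seq.mk_one.symm)] with i hi
  refine ⟨fun h => ?_, fun h c _ => Or.inr h⟩
  by_contra hf
  refine one_ne_zero (α := k) ?_
  rw [← hi]
  exact Finset.sum_eq_zero fun c hc => (h c hc).resolve_right hf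

theorem systemsHavePeriodicZeros_of_hasPVExtensionInSeq
    (h : ∀ (n : ℕ) (A : GL (Fin n) (RatFunc k)), HasPVExtensionInSeq A) :
    SystemsHavePeriodicZeros k := by
  intro n A v hv r
  obtain ⟨L, hL, hPV⟩ := h n A
  obtain ⟨Y, hY, -⟩ := hPV.generated
  refine periodicZeros_of_mem_pseudoField (R := L.toSubring) hL hPV.pseudoField ?_
  let Z : GL (Fin n) (Seq k) := Matrix.GeneralLinearGroup.map (L.val : L →+* Seq k) Y
  let B : GL (Fin n) (Seq k) := Matrix.GeneralLinearGroup.map (algebraMap _ (Seq k)) A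
  have hZ : Matrix.GeneralLinearGroup.map (shiftSeq k) Z = B * Z := by
    refine Units.ext (Matrix.ext fun r s => ?_)
    have := congrArg Subtype.val (congrFun (congrFun hY r) s)
    rw [Matrix.mul_apply, AddSubmonoidClass.coe_finsetSum] at this
    exact this
  have hvB : (fun r => shiftSeq k (v r)) = (B : Matrix (Fin n) (Fin n) (Seq k)).mulVec v := by
    funext r
    rw [hv r]
    simp only [Algebra.smul_def]
    rfl
  -- Variation of constants: `Z⁻¹ v` is shift-invariant, hence has constant entries, and `v = Z w`
  -- has entries in `L`.
  let w : Fin n → Seq k := ((Z⁻¹ : GL (Fin n) (Seq k)) : Matrix (Fin n) (Fin n) (Seq k)).mulVec v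
  have hw : ∀ s, shiftSeq k (w s) = w s := by
    intro s
    have h1 := (shiftSeq k).map_mulVec
      ((Z⁻¹ : GL (Fin n) (Seq k)) : Matrix (Fin n) (Fin n) (Seq k)) v s
    refine h1.trans ?_
    have h2 : (((Z⁻¹ : GL (Fin n) (Seq k)) : Matrix (Fin n) (Fin n) (Seq k)).map (shiftSeq k)) =
        (((B * Z)⁻¹ : GL (Fin n) (Seq k)) : Matrix (Fin n) (Fin n) (Seq k)) := by
      rw [← hZ, ← map_inv]
      rfl
    have h3 : (shiftSeq k) ∘ v = (B : Matrix (Fin n) (Fin n) (Seq k)).mulVec v := hvB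
    rw [h2, h3, Matrix.mulVec_mulVec, ← Units.val_mul, mul_inv_rev, inv_mul_cancel_right]
  have hwL : ∀ s, w s ∈ L := by
    intro s
    obtain ⟨c, hc⟩ := exists_eq_const_of_shiftSeq_eq (hw s)
    rw [hc, ← algebraMap_C]
    exact L.algebraMap_mem _
  have hvw : v = (Z : Matrix (Fin n) (Fin n) (Seq k)).mulVec w := by
    rw [Matrix.mulVec_mulVec, ← Units.val_mul, mul_inv_cancel, Units.val_one, Matrix.one_mulVec]
  change v r ∈ L
  rw [hvw, Matrix.mulVec, dotProduct]
  exact sum_mem fun s _ => mul_mem ((Y : Matrix (Fin n) (Fin n) L) r s).2 (hwL s)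

end PicardVessiot

/-! ### From scalar recurrences to systems -/

section Companion

/-- The companion matrix of `σⁿ⁺¹(y) + hₙ σⁿ(y) + ⋯ + h₀ y = 0`. -/
def companion {K : Type*} [Field K] {n : ℕ} (h : Fin (n + 1) → K) :
    Matrix (Fin (n + 1)) (Fin (n + 1)) K :=
  Fin.lastCases (fun j => -h j) fun i => Pi.single i.succ 1

theorem isUnit_companion {K : Type*} [Field K] {n : ℕ} {h : Fin (n + 1) → K} (h0 : h 0 ≠ 0) :
    IsUnit (companion h) := by
  rw [← Matrix.mulVec_injective_iff_isUnit, ← Matrix.coe_mulVecLin,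
    injective_iff_map_eq_zero (companion h).mulVecLin]
  intro w hw
  have hsucc : ∀ i : Fin n, w i.succ = 0 := fun i => by
    have := congrFun hw i.castSucc
    simpa [companion, Matrix.mulVec] using this
  have hlast := congrFun hw (Fin.last n)
  have h0w : w 0 = 0 := by
    simpa [companion, Matrix.mulVec, dotProduct, Fin.sum_univ_succ, hsucc, h0] using hlast
  funext i
  exact Fin.cases h0w hsucc i

variable {k : Type*} [Field k] [CharZero k]

/-- The companion matrix is invertible only if `h 0 ≠ 0`. Otherwise the shifted sequence satisfies a
recurrence of lower order, and induction applies. -/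
theorem eventuallyPeriodic_of_isSolution (hsys : SystemsHavePeriodicZeros k) {n : ℕ}
    (h : Fin n → RatFunc k) (f : ℕ → k) (hf : IsSolution h f) :
    EventuallyPeriodic {i | f i = 0} := by
  induction n generalizing f with
  | zero =>
    refine (EventuallyPeriodic.of_forall (S := Set.univ) fun _ => trivial).congr ?_
    filter_upwards [hf] with i hi
    simpa using hi
  | succ n ih =>
    by_cases h0 : h 0 = 0
    · refine EventuallyPeriodic.of_shift 1 (ih (fun j => h j.succ) (fun i => f (i + 1)) ?_)
      filter_upwards [hf] with i hi
      rw [Fin.sum_univ_succ, h0] at hi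
      simpa [value, ← add_assoc] using hi
    · refine Seq.periodicZeros_mk.1 (hsys (n + 1) (isUnit_companion h0).unit
        (fun j => (shiftSeq k)^[(j : ℕ)] (Seq.mk f)) (fun r => ?_) 0)
      rw [← Function.iterate_succ_apply' (shiftSeq k), IsUnit.unit_spec]
      refine Fin.lastCases ?_ (fun i => ?_) r
      · simp only [companion, Fin.lastCases_last, neg_smul, Finset.sum_neg_distrib]
        exact eq_neg_of_add_eq_zero_left (isSolution_iff.1 hf)
      · simp only [companion, Fin.lastCases_castSucc]
        rw [Finset.sum_eq_single i.succ (fun j _ hj => by rw [Pi.single_eq_of_ne hj, zero_smul])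
          (by simp), Pi.single_eq_same, one_smul]
        rfl

theorem periodicZeros_of_mem_recurrent
    (h : ∀ (n : ℕ) (h : Fin n → RatFunc k) (f : ℕ → k), IsSolution h f →
      IsFiniteUnionAP {i : ℕ | f i = 0}) : ∀ x ∈ recurrent k, x.PeriodicZeros := by
  intro x hx
  obtain ⟨f, rfl⟩ := x.exists_mk
  obtain ⟨n, c, hc⟩ := exists_isSolution hx
  exact Seq.periodicZeros_mk.2 (isFiniteUnionAP_iff.1 (h n c f hc))

end Companion

end DifferenceEq

end

theorem mainTheorem2 (k : Type*) [Field k] [CharZero k] :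
    List.TFAE [
      ∀ (n : ℕ) (A : GL (Fin n) (RatFunc k)) (Y : Set (DifferenceEq.Pt k n)),
        DifferenceEq.IsClosedSubvariety Y →
        ∀ x : DifferenceEq.Pt k n, DifferenceEq.OrbitDefined A x →
          DifferenceEq.IsFiniteUnionAP {i : ℕ | (DifferenceEq.step A)^[i] x ∈ Y},
      ∀ (n : ℕ) (h : Fin n → RatFunc k) (f : ℕ → k), DifferenceEq.IsSolution h f →
        DifferenceEq.IsFiniteUnionAP {i : ℕ | f i = 0},
      ∀ (n : ℕ) (A : GL (Fin n) (RatFunc k)), DifferenceEq.HasPVExtensionInSeq A] := by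
  tfae_have 1 → 2 := fun h _ c f hf => DifferenceEq.isFiniteUnionAP_iff.2 <|
    DifferenceEq.eventuallyPeriodic_of_isSolution
      (DifferenceEq.systemsHavePeriodicZeros_of_orbits h) c f hf
  tfae_have 2 → 1 := fun h _ A _ hY _ hx => DifferenceEq.isFiniteUnionAP_orbit
    (DifferenceEq.periodicZeros_of_mem_recurrent h) A hY hx
  tfae_have 3 → 2 := fun h _ c f hf => DifferenceEq.isFiniteUnionAP_iff.2 <|
    DifferenceEq.eventuallyPeriodic_of_isSolution
      (DifferenceEq.systemsHavePeriodicZeros_of_hasPVExtensionInSeq h) c f hf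
  tfae_have 2 → 3 := fun h _ A => DifferenceEq.hasPVExtensionInSeq_of_periodicZeros
    (DifferenceEq.periodicZeros_of_mem_recurrent h) A
  tfae_finish
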